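/- Let $X$ be a connected complex manifold (not necessarily compact or Kähler) and let $x_0\in X$. Let $\mathbb C^\times$ also denote the constant sheaf on $X$ (the sheaf of locally constant functions with values in $\mathbb C^\times$), let $\mathcal O^\times$ be the sheaf of nowhere vanishing holomorphic functions, and let $\iota^*: H^1(X,\mathbb C^\times)\to H^1(X,\mathcal O^\times)$ be the homomorphism induced by the inclusion $\iota:\mathbb C^\times\hookrightarrow\mathcal O^\times$, where $H^1$ is Čech cohomology (the direct limit over open covers). Let $\mathrm{Pic}(X)$ be the set of isomorphism classes of holomorphic line bundles on $X$, identified with $H^1(X,\mathcal O^\times)$ by sending a line bundle to the class of its transition functions $g_{\alpha\beta}=\varphi_\alpha\circ\varphi_\beta^{-1}$, where the $\varphi_\alpha$ are local trivializations. Let $p:\tilde X\to X$ be a universal cover (a covering map with $\tilde X$ simply connected) and let $\tilde x_0\in p^{-1}(x_0)$. The group $\pi_1(X,x_0)$ acts on $\tilde X$ by deck transformations: the class of a loop $\sigma$ acts by the deck transformation that sends $\tilde x_0$ to the end point of the lift of $\sigma$ starting at $\tilde x_0$. For $\rho\in\mathrm{Hom}(\pi_1(X,x_0),\mathbb C^\times)$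 let $$L_\rho=\tilde X\times_{\pi_1(X,x_0)}\mathbb C_\rho=(\tilde X\times\mathbb C)/\big((\tilde z,c)\sim(\sigma\cdot\tilde z,\rho(\sigma)c)\big),$$ a holomorphic line bundle on $X$, and let $\lambda_{\tilde X}:\mathrm{Hom}(\pi_1(X,x_0),\mathbb C^\times)\to\mathrm{Pic}(X)$, $\rho\mapsto[L_\rho]$, be the character map of $\tilde X$. Then there is an isomorphism of groups $$\psi:\mathrm{Hom}(\pi_1(X,x_0),\mathbb C^\times)\;\xrightarrow{\ \sim\ }\;H^1(X,\mathbb C^\times),$$ which can be chosen independently of $(\tilde X,p,\tilde x_0)$, such that $\iota^*\circ\psi=\lambda_{\tilde X}$ under the identification $\mathrm{Pic}(X)=H^1(X,\mathcal O^\times)$. -/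

import Mathlib

open scoped Manifold ContDiff Topology
open TopologicalSpace Bundle

universe u v w

/-! ## Čech cohomology in degree one with coefficients in sheaves of `ℂˣ`-valued functions -/

/-- A sheaf of abelian groups on `X` whose sections over an open set `U` are the functions
`U → ℂˣ` in a prescribed subgroup; the membership condition is stable under restriction and
local, so that sections glue. -/
structure UnitSheaf (X : Type u) [TopologicalSpace X] where
  sections : (U : Opens X) → Subgroup (U → ℂˣ)
  restrict_mem : ∀ {U V : Opens X} (h : V ≤ U) {f : U → ℂˣ}, f ∈ sections U →
    f ∘ Set.inclusion h ∈ sections V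
  mem_of_local : ∀ {U : Opens X} {f : U → ℂˣ},
    (∀ x : U, ∃ (V : Opens X) (h : V ≤ U), x.1 ∈ V ∧ f ∘ Set.inclusion h ∈ sections V) →
    f ∈ sections U

/-- `A ≤ B` means that `A` is a subsheaf of `B`. -/
instance UnitSheaf.instLE {X : Type u} [TopologicalSpace X] : LE (UnitSheaf X) where
  le A B := ∀ U : Opens X, A.sections U ≤ B.sections U

/-- The constant sheaf `ℂˣ`: its sections are the locally constant functions. -/
def constantUnits (X : Type u) [TopologicalSpace X] : UnitSheaf X where
  sections U :=
    { carrier := {f | IsLocallyConstant f}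
      one_mem' := IsLocallyConstant.const 1
      mul_mem' := fun hf hg => hf.mul hg
      inv_mem' := fun hf => hf.inv }
  restrict_mem h f hf := IsLocallyConstant.comp_continuous hf (continuous_inclusion h)
  mem_of_local {U f} hf := by
    refine (IsLocallyConstant.iff_eventually_eq f).2 fun x => ?_
    obtain ⟨V, h, hx, hV⟩ := hf x
    have h1 := (IsLocallyConstant.iff_eventually_eq _).1 hV ⟨x.1, hx⟩
    have ho : Topology.IsOpenEmbedding (Set.inclusion h) :=
      ⟨Topology.IsEmbedding.inclusion h, by
        rw [Set.range_inclusion h]; exact V.2.preimage continuous_subtype_val⟩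
    have h2 := ho.map_nhds_eq ⟨x.1, hx⟩
    have h3 : Set.inclusion h ⟨x.1, hx⟩ = x := rfl
    rw [h3] at h2
    rw [← h2]
    exact h1

/-- The sheaf `𝒪ˣ`: its sections are the nowhere vanishing holomorphic functions. -/
def holomorphicUnits (E : Type w) [NormedAddCommGroup E] [NormedSpace ℂ E]
    (X : Type u) [TopologicalSpace X] [ChartedSpace E X] : UnitSheaf X where
  sections U :=
    { carrier := {f | ContMDiff 𝓘(ℂ, E) 𝓘(ℂ) ω (fun x : U => (f x : ℂ))}
      one_mem' := contMDiff_const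
      mul_mem' := fun hf hg => by
        simp only [Set.mem_ofPred_eq, Pi.mul_apply, Units.val_mul] at *
        exact ContMDiff.mul hf hg
      inv_mem' := fun {f} hf => by
        simp only [Set.mem_ofPred_eq, Pi.inv_apply, Units.val_inv_eq_inv_val] at *
        exact ContMDiff.inv₀ hf fun x => (f x).ne_zero }
  restrict_mem {U V} h f hf := by
    have hf' : ContMDiff 𝓘(ℂ, E) 𝓘(ℂ) ω (fun x : U => (f x : ℂ)) := hf
    exact hf'.comp (contMDiff_inclusion h)
  mem_of_local {U f} hf := by
    intro x
    obtain ⟨V, h, hx, hV⟩ := hf x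
    obtain ⟨g, hg⟩ : ∃ g : X → ℂ, ∀ y : U, (f y : ℂ) = g y := by
      classical
      exact ⟨fun y => if hy : y ∈ U then (f ⟨y, hy⟩ : ℂ) else 0, fun y => by simp [y.2]⟩
    have h1 := hV ⟨x.1, hx⟩
    have e1 : (fun y : V => (((f ∘ Set.inclusion h) y : ℂˣ) : ℂ)) = fun y : V => g y := by
      funext y; exact hg _
    have e2 : (fun y : U => (f y : ℂ)) = fun y : U => g y := by
      funext y; exact hg _
    rw [e1, contMDiffAt_subtype_iff] at h1
    rw [e2, contMDiffAt_subtype_iff]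
    exact h1

/-- Locally constant functions are holomorphic. -/
theorem constantUnits_le_holomorphicUnits (E : Type w) [NormedAddCommGroup E] [NormedSpace ℂ E]
    (X : Type u) [TopologicalSpace X] [ChartedSpace E X] :
    constantUnits X ≤ holomorphicUnits E X := by
  intro U f hf
  show ContMDiff 𝓘(ℂ, E) 𝓘(ℂ) ω (fun x : U => (f x : ℂ))
  intro x
  have h1 := (IsLocallyConstant.iff_eventually_eq f).1 hf x
  refine (contMDiffAt_const (c := (f x : ℂ))).congr_of_eventuallyEq ?_
  filter_upwards [h1] with y hy
  rw [hy]

/-- An open cover of `X` indexed by the points of `X`: an open neighbourhood of every point.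
Every open cover is refined by such a cover. -/
structure PointedCover (X : Type u) [TopologicalSpace X] where
  nhd : X → Opens X
  mem_nhd : ∀ x, x ∈ nhd x

namespace PointedCover

variable {X : Type u} [TopologicalSpace X]

/-- `𝒰 ≤ 𝒱` means that `𝒱` is finer than `𝒰`. -/
instance instPreorder : Preorder (PointedCover X) where
  le 𝒰 𝒱 := ∀ x, 𝒱.nhd x ≤ 𝒰.nhd x
  le_refl _ _ := le_rfl
  le_trans _ _ _ h h' x := (h' x).trans (h x)

instance instNonempty : Nonempty (PointedCover X) := ⟨⟨fun _ => ⊤, fun _ => trivial⟩⟩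

instance instIsDirectedOrder : IsDirectedOrder (PointedCover X) where
  directed 𝒰 𝒱 := ⟨⟨fun x => 𝒰.nhd x ⊓ 𝒱.nhd x, fun x => ⟨𝒰.mem_nhd x, 𝒱.mem_nhd x⟩⟩,
    fun _ => inf_le_left, fun _ => inf_le_right⟩

end PointedCover

namespace Cech

variable {X : Type u} [TopologicalSpace X]

/-- The group of families of functions on the pairwise intersections of a cover. -/
abbrev PairFunctions (𝒰 : PointedCover X) : Type u :=
  ∀ x y : X, (𝒰.nhd x ⊓ 𝒰.nhd y : Opens X) → ℂˣ

/-- The group `Z¹(𝒰, A)` of Čech one-cocycles: families `g x y ∈ A(U x ∩ U y)` with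
`g x y * g y z = g x z` on `U x ∩ U y ∩ U z`. -/
def cocycles (A : UnitSheaf X) (𝒰 : PointedCover X) : Subgroup (PairFunctions 𝒰) where
  carrier := {g | (∀ x y, g x y ∈ A.sections (𝒰.nhd x ⊓ 𝒰.nhd y)) ∧
    ∀ (x y z w : X) (hx : w ∈ 𝒰.nhd x) (hy : w ∈ 𝒰.nhd y) (hz : w ∈ 𝒰.nhd z),
      g x y ⟨w, hx, hy⟩ * g y z ⟨w, hy, hz⟩ = g x z ⟨w, hx, hz⟩}
  one_mem' := ⟨fun x y => (A.sections _).one_mem, fun _ _ _ _ _ _ _ => by simp⟩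
  mul_mem' := fun {g g'} hg hg' => ⟨fun x y => (A.sections _).mul_mem (hg.1 x y) (hg'.1 x y),
    fun x y z w hx hy hz => by
      simp only [Pi.mul_apply]
      rw [← hg.2 x y z w hx hy hz, ← hg'.2 x y z w hx hy hz, mul_mul_mul_comm]⟩
  inv_mem' := fun {g} hg => ⟨fun x y => (A.sections _).inv_mem (hg.1 x y),
    fun x y z w hx hy hz => by
      simp only [Pi.inv_apply]
      rw [← hg.2 x y z w hx hy hz, mul_inv]⟩

/-- The coboundary of a family `f x : U x → ℂˣ`, namely `f x / f y` on `U x ∩ U y`. -/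
def coboundary (𝒰 : PointedCover X) : (∀ x : X, 𝒰.nhd x → ℂˣ) →* PairFunctions 𝒰 where
  toFun f x y w := f x ⟨w.1, w.2.1⟩ / f y ⟨w.1, w.2.2⟩
  map_one' := by funext x y w; simp
  map_mul' f f' := by funext x y w; simp [mul_div_mul_comm]

/-- The group `B¹(𝒰, A)` of Čech one-coboundaries `f x / f y` with `f x ∈ A(U x)`. -/
def coboundaries (A : UnitSheaf X) (𝒰 : PointedCover X) : Subgroup (PairFunctions 𝒰) :=
  (Subgroup.pi Set.univ fun x => A.sections (𝒰.nhd x)).map (coboundary 𝒰)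

/-- The group `H¹(𝒰, A) = Z¹(𝒰, A) / B¹(𝒰, A)`. -/
abbrev H1Cover (A : UnitSheaf X) (𝒰 : PointedCover X) : Type u :=
  cocycles A 𝒰 ⧸ (coboundaries A 𝒰).subgroupOf (cocycles A 𝒰)

/-- Restriction of families of functions to a finer cover. -/
def restrictPair {𝒰 𝒱 : PointedCover X} (h : 𝒰 ≤ 𝒱) : PairFunctions 𝒰 →* PairFunctions 𝒱 where
  toFun g x y w := g x y ⟨w.1, h x w.2.1, h y w.2.2⟩
  map_one' := rfl
  map_mul' _ _ := rfl

theorem restrictPair_mem_cocycles {A B : UnitSheaf X} (hAB : A ≤ B) {𝒰 𝒱 : PointedCover X}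
    (h : 𝒰 ≤ 𝒱) {g : PairFunctions 𝒰} (hg : g ∈ cocycles A 𝒰) :
    restrictPair h g ∈ cocycles B 𝒱 :=
  ⟨fun x y => hAB _ (A.restrict_mem (inf_le_inf (h x) (h y)) (hg.1 x y)),
    fun x y z w hx hy hz => hg.2 x y z w (h x hx) (h y hy) (h z hz)⟩

theorem restrictPair_mem_coboundaries {A B : UnitSheaf X} (hAB : A ≤ B) {𝒰 𝒱 : PointedCover X}
    (h : 𝒰 ≤ 𝒱) {g : PairFunctions 𝒰} (hg : g ∈ coboundaries A 𝒰) :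
    restrictPair h g ∈ coboundaries B 𝒱 := by
  obtain ⟨f, hf, rfl⟩ := hg
  exact ⟨fun x => f x ∘ Set.inclusion (h x),
    fun x hx => hAB _ (A.restrict_mem (h x) (hf x hx)), rfl⟩

/-- The homomorphism `H¹(𝒰, A) → H¹(𝒱, B)` for a subsheaf `A` of `B` and a cover `𝒱` finer
than `𝒰`, induced by restricting cocycles. -/
def restrictH1 {A B : UnitSheaf X} (hAB : A ≤ B) {𝒰 𝒱 : PointedCover X} (h : 𝒰 ≤ 𝒱) :
    H1Cover A 𝒰 →* H1Cover B 𝒱 :=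
  QuotientGroup.map _ _
    (((restrictPair h).comp (cocycles A 𝒰).subtype).codRestrict (cocycles B 𝒱)
      fun g => restrictPair_mem_cocycles hAB h g.2)
    fun _ hg => restrictPair_mem_coboundaries hAB h hg

/-- A sheaf is a subsheaf of itself. -/
theorem le_self (A : UnitSheaf X) : A ≤ A := fun _ => le_rfl

instance instDirectedSystem (A : UnitSheaf X) :
    DirectedSystem (H1Cover A) (fun _ _ h => restrictH1 (le_self A) h) where
  map_self _ c := by
    induction c using QuotientGroup.induction_on
    rfl
  map_map _ _ _ _ _ c := by
    induction c using QuotientGroup.induction_on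
    rfl

/-- The first cohomology group `H¹(X, A)`: the direct limit of the groups `H¹(𝒰, A)` over all
open covers `𝒰`, ordered by refinement. -/
abbrev H1 (A : UnitSheaf X) : Type u :=
  DirectLimit (H1Cover A) (fun _ _ h => restrictH1 (le_self A) h)

/-- The cohomology class of a cocycle. -/
def H1.mk {A : UnitSheaf X} (𝒰 : PointedCover X) (g : cocycles A 𝒰) : H1 A :=
  ⟦⟨𝒰, (g : H1Cover A 𝒰)⟩⟧

/-- The homomorphism `H¹(X, A) → H¹(X, B)` induced by the inclusion of a subsheaf `A` of `B`. -/
def H1.map {A B : UnitSheaf X} (hAB : A ≤ B) : H1 A →* H1 B where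
  toFun := DirectLimit.map _ _ (fun _ => restrictH1 hAB le_rfl) fun _ _ _ c => by
    induction c using QuotientGroup.induction_on
    rfl
  map_one' := by
    rw [DirectLimit.one_def ⟨fun _ => ⊤, fun _ => trivial⟩,
      DirectLimit.one_def ⟨fun _ => ⊤, fun _ => trivial⟩, DirectLimit.map_def]
    simp
  map_mul' := DirectLimit.induction₂ _ fun i c d => by
    simp only [DirectLimit.mul_def, DirectLimit.map_def, map_mul]

end Cech

/-! ## Holomorphic line bundles and the Picard group -/

section LineBundles

variable (E : Type w) [NormedAddCommGroup E] [NormedSpace ℂ E]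
  (X : Type u) [TopologicalSpace X] [ChartedSpace E X]

/-- A holomorphic line bundle on `X`: a complex vector bundle with model fibre `ℂ` whose
transition functions are holomorphic. -/
structure HolomorphicLineBundle where
  Fiber : X → Type v
  [addCommGroup : ∀ x, AddCommGroup (Fiber x)]
  [module : ∀ x, Module ℂ (Fiber x)]
  [topologicalSpace : ∀ x, TopologicalSpace (Fiber x)]
  [totalTopology : TopologicalSpace (TotalSpace ℂ Fiber)]
  [fiberBundle : FiberBundle ℂ Fiber]
  [vectorBundle : VectorBundle ℂ ℂ Fiber]
  [holomorphic : ContMDiffVectorBundle ω ℂ Fiber 𝓘(ℂ, E)]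

attribute [instance] HolomorphicLineBundle.addCommGroup HolomorphicLineBundle.module
  HolomorphicLineBundle.topologicalSpace HolomorphicLineBundle.totalTopology
  HolomorphicLineBundle.fiberBundle HolomorphicLineBundle.vectorBundle
  HolomorphicLineBundle.holomorphic

namespace HolomorphicLineBundle

variable {E X}

/-- Two holomorphic line bundles are isomorphic if there is a fibrewise linear bijection over `X`
between them that is holomorphic, with holomorphic inverse, on total spaces. -/
def Isomorphic (L L' : HolomorphicLineBundle.{u, v, w} E X) : Prop :=
  ∃ φ : ∀ x, L.Fiber x ≃ₗ[ℂ] L'.Fiber x,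
    ContMDiff (𝓘(ℂ, E).prod 𝓘(ℂ)) (𝓘(ℂ, E).prod 𝓘(ℂ)) ω
      (fun a : TotalSpace ℂ L.Fiber => (⟨a.1, φ a.1 a.2⟩ : TotalSpace ℂ L'.Fiber)) ∧
    ContMDiff (𝓘(ℂ, E).prod 𝓘(ℂ)) (𝓘(ℂ, E).prod 𝓘(ℂ)) ω
      (fun a : TotalSpace ℂ L'.Fiber => (⟨a.1, (φ a.1).symm a.2⟩ : TotalSpace ℂ L.Fiber))

variable (E X) in
/-- Isomorphism of holomorphic line bundles is an equivalence relation. -/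
def setoid : Setoid (HolomorphicLineBundle.{u, v, w} E X) where
  r := Isomorphic
  iseqv :=
    { refl := fun L => ⟨fun x => LinearEquiv.refl ℂ (L.Fiber x), contMDiff_id, contMDiff_id⟩
      symm := fun ⟨φ, h, h'⟩ => ⟨fun x => (φ x).symm, h', h⟩
      trans := fun ⟨φ, h, h'⟩ ⟨φ', k, k'⟩ => ⟨fun x => (φ x).trans (φ' x), k.comp h, h'.comp k'⟩ }

variable (L L' : HolomorphicLineBundle.{u, v, w} E X)

/-- The preferred local trivialization of `L` around `x`. -/
noncomputable abbrev triv (x : X) : Trivialization ℂ (TotalSpace.proj : TotalSpace ℂ L.Fiber → X) :=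
  trivializationAt ℂ L.Fiber x

/-- The cover of `X` by the domains of the preferred local trivializations of `L`. -/
noncomputable def cover : PointedCover X where
  nhd x := ⟨(L.triv x).baseSet, (L.triv x).open_baseSet⟩
  mem_nhd x := FiberBundle.mem_baseSet_trivializationAt' x

/-- The linear isomorphism of the fibre of `L` over `b` with `ℂ` given by the local
trivialization around `x`. -/
noncomputable def coord (x b : X) (hb : b ∈ L.cover.nhd x) : L.Fiber b ≃L[ℂ] ℂ :=
  (L.triv x).continuousLinearEquivAt ℂ b hb

/-- The transition functions `g x y` of `L`: if `φ x` denotes the local trivialization of `L`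
around `x`, then `φ x ∘ (φ y)⁻¹` is multiplication by `g x y`. -/
noncomputable def transition : Cech.PairFunctions L.cover := fun x y b =>
  Units.mk0 (L.coord x b.1 b.2.1 ((L.coord y b.1 b.2.2).symm 1)) (by simp)

theorem transition_mul (x y b : X) (hx : b ∈ L.cover.nhd x) (hy : b ∈ L.cover.nhd y) (c : ℂ) :
    (L.transition x y ⟨b, hx, hy⟩ : ℂ) * c = L.coord x b hx ((L.coord y b hy).symm c) := by
  have h : (L.coord y b hy).symm c = c • (L.coord y b hy).symm 1 := by
    rw [← map_smul, smul_eq_mul, mul_one]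
  rw [h, map_smul, smul_eq_mul, mul_comm]
  rfl

theorem transition_mem_cocycles : L.transition ∈ Cech.cocycles (holomorphicUnits E X) L.cover := by
  refine ⟨fun x y => ?_, fun x y z b hx hy hz => ?_⟩
  · intro b
    have h := (contMDiffAt_coordChangeL (n := ω) (IB := 𝓘(ℂ, E)) (e := L.triv y) (e' := L.triv x)
      b.2.2 b.2.1).clm_apply (contMDiffAt_const (c := (1 : ℂ)))
    have h' := contMDiffAt_subtype_iff (U := L.cover.nhd x ⊓ L.cover.nhd y) |>.2 h
    refine h'.congr_of_eventuallyEq (Filter.Eventually.of_forall fun b' => ?_)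
    have := (L.triv y).comp_continuousLinearEquivAt_eq_coord_change (R := ℂ) (L.triv x)
      (b := b'.1) ⟨b'.2.2, b'.2.1⟩
    exact congrArg (fun f : ℂ ≃L[ℂ] ℂ => f 1) this
  · ext
    rw [Units.val_mul]
    rw [show (L.transition y z ⟨b, hy, hz⟩ : ℂ) =
      L.coord y b hy ((L.coord z b hz).symm 1) from rfl, transition_mul _ _ _ _ hx hy]
    simp [transition]

/-- The class in `H¹(X, 𝒪ˣ)` of the transition functions of `L`. -/
noncomputable def transitionClass : Cech.H1 (holomorphicUnits E X) :=
  Cech.H1.mk L.cover ⟨L.transition, L.transition_mem_cocycles⟩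

variable {L L'}

theorem Isomorphic.transitionClass_eq (h : L.Isomorphic L') :
    L.transitionClass = L'.transitionClass := by
  obtain ⟨φ, hφ, -⟩ := h
  let 𝒲 : PointedCover X := ⟨fun x => L.cover.nhd x ⊓ L'.cover.nhd x,
    fun x => ⟨L.cover.mem_nhd x, L'.cover.mem_nhd x⟩⟩
  have h1 : L.cover ≤ 𝒲 := fun _ => inf_le_left
  have h2 : L'.cover ≤ 𝒲 := fun _ => inf_le_right
  refine Quotient.sound ⟨𝒲, h1, h2, ?_⟩
  refine QuotientGroup.eq.2 ?_
  let f : ∀ x : X, 𝒲.nhd x → ℂˣ := fun x b =>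
    Units.mk0 (L'.coord x b.1 b.2.2 (φ b.1 ((L.coord x b.1 b.2.1).symm 1))) (by simp)
  have hmul : ∀ (x b : X) (hb : b ∈ L.cover.nhd x) (hb' : b ∈ L'.cover.nhd x) (c : ℂ),
      (f x ⟨b, hb, hb'⟩ : ℂ) * c = L'.coord x b hb' (φ b ((L.coord x b hb).symm c)) := by
    intro x b hb hb' c
    have h : (L.coord x b hb).symm c = c • (L.coord x b hb).symm 1 := by
      rw [← map_smul, smul_eq_mul, mul_one]
    rw [h, map_smul, map_smul, smul_eq_mul, mul_comm]
    rfl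
  refine ⟨f, fun x _ => ?_, ?_⟩
  · intro b
    have hs : ContMDiffAt 𝓘(ℂ, E) (𝓘(ℂ, E).prod 𝓘(ℂ)) ω
        (fun b : X => ((L.triv x).toOpenPartialHomeomorph.symm (b, (1 : ℂ)))) b.1 := by
      have hm : (b.1, (1 : ℂ)) ∈ (L.triv x).target := (L.triv x).mem_target.2 b.2.1
      have := ((L.triv x).contMDiffOn_symm (n := ω) (IB := 𝓘(ℂ, E))).contMDiffAt
        ((L.triv x).open_target.mem_nhds hm)
      exact this.comp b.1 (contMDiffAt_id.prodMk contMDiffAt_const)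
    have hs2 := (hφ _).comp b.1 hs
    have hp : (((L.triv x).toOpenPartialHomeomorph.symm (b.1, (1 : ℂ)))).1 = b.1 :=
      (L.triv x).proj_symm_apply' b.2.1
    have hs3 := ((L'.triv x).contMDiffAt_iff (n := ω) (IB := 𝓘(ℂ, E)) (by
      rw [(L'.triv x).mem_source]; simp only [Function.comp]; rw [hp]; exact b.2.2)).1 hs2
    have h' := contMDiffAt_subtype_iff (U := 𝒲.nhd x) |>.2 hs3.2
    refine h'.congr_of_eventuallyEq (Filter.Eventually.of_forall fun b' => ?_)
    have := (L.triv x).symm_apply_eq_mk_continuousLinearEquivAt_symm (R := ℂ) b'.1 b'.2.1 (1 : ℂ)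
    exact (congrArg (fun a : TotalSpace ℂ L.Fiber =>
      (L'.triv x (⟨a.1, φ a.1 a.2⟩ : TotalSpace ℂ L'.Fiber)).2) this).symm
  · funext x y b
    obtain ⟨b, ⟨hx, hx'⟩, hy, hy'⟩ := b
    change f x ⟨b, hx, hx'⟩ / f y ⟨b, hy, hy'⟩ =
      (L.transition x y ⟨b, hx, hy⟩)⁻¹ * L'.transition x y ⟨b, hx', hy'⟩
    have key : f x ⟨b, hx, hx'⟩ * L.transition x y ⟨b, hx, hy⟩ =
        L'.transition x y ⟨b, hx', hy'⟩ * f y ⟨b, hy, hy'⟩ := by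
      ext
      rw [Units.val_mul, Units.val_mul, hmul _ _ hx hx', transition_mul _ _ _ _ hx' hy']
      simp [transition, f]
    rw [div_eq_iff_eq_mul, mul_assoc, ← key, mul_comm (f x _), inv_mul_cancel_left]

end HolomorphicLineBundle

/-- The Picard group `Pic X`, as the set of isomorphism classes of holomorphic line bundles. -/
def Pic : Type (max u (v + 1)) := Quotient (HolomorphicLineBundle.setoid.{u, v, w} E X)

/-- The canonical identification `Pic X = H¹(X, 𝒪ˣ)`: the class of a line bundle is sent to the
class of its transition functions. -/
noncomputable def Pic.toH1 {E : Type w} [NormedAddCommGroup E] [NormedSpace ℂ E]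
    {X : Type u} [TopologicalSpace X] [ChartedSpace E X] : Pic.{u, v, w} E X → Cech.H1 (holomorphicUnits E X) :=
  Quotient.lift HolomorphicLineBundle.transitionClass fun _ _ h =>
    HolomorphicLineBundle.Isomorphic.transitionClass_eq h

end LineBundles

/-! ## Line bundles associated with characters of the group of a covering -/

namespace Assoc

variable {X : Type u} [TopologicalSpace X] {Y : Type v} [TopologicalSpace Y] {p : Y → X}
  {G : Type v} [Group G] [MulAction G Y]

/-- The equivalence relation `(z, c) ∼ (g z, χ(g) c)` for `g ∈ G` on `p⁻¹(x) × ℂ`. -/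
def fiberSetoid (χ : G →* ℂˣ) (x : X) : Setoid ((p ⁻¹' {x}) × ℂ) where
  r a b := ∃ g : G, g • (a.1 : Y) = b.1 ∧ (χ g : ℂ) * a.2 = b.2
  iseqv :=
    { refl := fun a => ⟨1, by simp, by simp⟩
      symm := fun {a b} ⟨g, h, h'⟩ => ⟨g⁻¹, by rw [← h, inv_smul_smul], by rw [← h']; simp⟩
      trans := fun {a b c} ⟨g, h, h'⟩ ⟨k, l, l'⟩ => ⟨k * g, by rw [mul_smul, h, l], by
        rw [← l', ← h', map_mul, Units.val_mul, mul_assoc]⟩ }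

/-- The fibre over `x` of the line bundle `Y ×_G ℂ_χ = (Y × ℂ) / G`, where `G` acts by
`g (z, c) = (g z, χ(g) c)`; here `p : Y → X` is the covering with group `G`. -/
def Fiber (_hp : IsQuotientCoveringMap p G) (χ : G →* ℂˣ) (x : X) : Type v :=
  Quotient (fiberSetoid (p := p) χ x)

variable (hp : IsQuotientCoveringMap p G) (χ : G →* ℂˣ)

/-- The class `[z, c]` in the fibre of `Y ×_G ℂ_χ` over `x = p(z)`. -/
def mk {x : X} (z : p ⁻¹' {x}) (c : ℂ) : Fiber hp χ x :=
  Quotient.mk (fiberSetoid χ x) (z, c)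

theorem mk_smul {x : X} (z z' : p ⁻¹' {x}) (g : G) (h : g • (z : Y) = z') (c : ℂ) :
    mk hp χ z' (χ g * c) = mk hp χ z c :=
  (Quotient.sound (s := fiberSetoid χ x) (⟨g, h, rfl⟩ :
    (fiberSetoid χ x).r (z, c) (z', χ g * c))).symm

/-- The bijection `[z, c] ↦ c` of the fibre of `Y ×_G ℂ_χ` over `x` with `ℂ` given by a point `z`
of `Y` over `x`. -/
noncomputable def fiberEquiv {x : X} (z : p ⁻¹' {x}) : Fiber hp χ x ≃ ℂ where
  toFun := Quotient.lift (fun a => (χ (hp.fiberEquivGroup a.1 z) : ℂ) * a.2) (by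
    rintro ⟨a, c⟩ ⟨b, d⟩ ⟨g, h, h'⟩
    dsimp only at h h' ⊢
    have : hp.fiberEquivGroup a z = hp.fiberEquivGroup b z * g := by
      rw [hp.fiberEquivGroup_eq_iff, mul_smul, h, hp.fiberEquivGroup_smul_self]
    rw [this, ← h', map_mul, Units.val_mul, mul_assoc])
  invFun := mk hp χ z
  left_inv := by
    rintro ⟨a, c⟩
    exact mk_smul hp χ a z _ (hp.fiberEquivGroup_smul_self a) c
  right_inv c := by
    change (χ (hp.fiberEquivGroup z z) : ℂ) * c = c
    simp

theorem fiberEquiv_mk {x : X} (z : p ⁻¹' {x}) (c : ℂ) : fiberEquiv hp χ z (mk hp χ z c) = c :=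
  (fiberEquiv hp χ z).right_inv c

theorem fiberEquiv_eq {x : X} (z z' : p ⁻¹' {x}) (g : G) (h : g • (z : Y) = z')
    (q : Fiber hp χ x) : fiberEquiv hp χ z' q = χ g * fiberEquiv hp χ z q := by
  obtain ⟨c, rfl⟩ := (fiberEquiv hp χ z).symm.surjective q
  rw [Equiv.apply_symm_apply]
  change fiberEquiv hp χ z' (mk hp χ z c) = _
  rw [← mk_smul hp χ z z' g h, fiberEquiv_mk]

/-- A point of `Y` over a given point of `X`. -/
noncomputable def point (x : X) : p ⁻¹' {x} :=
  ⟨(hp.surjective x).choose, (hp.surjective x).choose_spec⟩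

noncomputable instance instAddCommGroup (x : X) : AddCommGroup (Fiber hp χ x) :=
  (fiberEquiv hp χ (point hp x)).addCommGroup

noncomputable instance instModule (x : X) : Module ℂ (Fiber hp χ x) :=
  (fiberEquiv hp χ (point hp x)).module ℂ

noncomputable instance instTopologicalSpace (x : X) : TopologicalSpace (Fiber hp χ x) :=
  TopologicalSpace.induced (fiberEquiv hp χ (point hp x)) inferInstance

/-- The vector space structure on the fibres does not depend on choices: the bijection `[z, c] ↦ c`
is linear for every `z`. -/
theorem fiberEquiv_isLinearMap {x : X} (z : p ⁻¹' {x}) :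
    IsLinearMap ℂ (fiberEquiv hp χ z) := by
  have h := fiberEquiv_eq hp χ (point hp x) z _ (hp.fiberEquivGroup_smul_self _)
  have hadd : ∀ q r, fiberEquiv hp χ (point hp x) (q + r) =
      fiberEquiv hp χ (point hp x) q + fiberEquiv hp χ (point hp x) r :=
    fun q r => Equiv.apply_symm_apply _ _
  have hsmul : ∀ (c : ℂ) q, fiberEquiv hp χ (point hp x) (c • q) =
      c • fiberEquiv hp χ (point hp x) q :=
    fun q r => Equiv.apply_symm_apply _ _
  constructor
  · intro q r
    rw [h, h, h, hadd, mul_add]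
  · intro c q
    rw [h, h, hsmul, smul_eq_mul, smul_eq_mul, mul_left_comm]

/-- A section of `p` that is continuous on an open set. -/
structure LocalSection (p : Y → X) where
  toFun : X → Y
  right_inv : ∀ x, p (toFun x) = x
  dom : Set X
  isOpen_dom : IsOpen dom
  continuousOn : ContinuousOn toFun dom

/-- The value of a section, as a point of the fibre. -/
def LocalSection.val (s : LocalSection p) (x : X) : p ⁻¹' {x} := ⟨s.toFun x, s.right_inv x⟩

theorem exists_localSection (hp : IsQuotientCoveringMap p G) (x : X) :
    ∃ s : LocalSection p, x ∈ s.dom := by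
  obtain ⟨e, he, hpe⟩ := hp.isCoveringMap.isLocalHomeomorph (point hp x).1
  classical
  refine ⟨⟨fun b => if b ∈ e.target then e.symm b else (point hp b).1, fun b => ?_, e.target,
    e.open_target, ?_⟩, ?_⟩
  · split_ifs with hb
    · rw [hpe]; exact e.right_inv hb
    · exact (point hp b).2
  · exact e.continuousOn_symm.congr fun b hb => if_pos hb
  · have h1 := e.map_source he
    rw [← hpe] at h1
    have h2 : p (point hp x).1 = x := (point hp x).2
    rwa [h2] at h1

/-- The local trivialization `[s(x), c] ↦ (x, c)` of `Y ×_G ℂ_χ` given by a local section `s`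
of `p`. -/
noncomputable def pretriv (s : LocalSection p) :
    Pretrivialization ℂ (TotalSpace.proj : TotalSpace ℂ (Fiber hp χ) → X) where
  toFun a := (a.1, fiberEquiv hp χ (s.val a.1) a.2)
  invFun b := ⟨b.1, mk hp χ (s.val b.1) b.2⟩
  source := TotalSpace.proj ⁻¹' s.dom
  target := s.dom ×ˢ Set.univ
  map_source' a ha := ⟨ha, trivial⟩
  map_target' b hb := hb.1
  left_inv' a _ := by
    obtain ⟨x, q⟩ := a
    exact congrArg (TotalSpace.mk x) ((fiberEquiv hp χ (s.val x)).left_inv q)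
  right_inv' b _ := by
    obtain ⟨x, c⟩ := b
    exact Prod.ext rfl (fiberEquiv_mk hp χ _ c)
  open_target := s.isOpen_dom.prod isOpen_univ
  baseSet := s.dom
  open_baseSet := s.isOpen_dom
  source_eq := rfl
  target_eq := rfl
  proj_toFun _ _ := rfl

theorem pretriv_symm (s : LocalSection p) {x : X} (hx : x ∈ s.dom) (c : ℂ) :
    (pretriv hp χ s).symm x c = mk hp χ (s.val x) c := by
  rw [Pretrivialization.symm_apply _ hx]
  rfl

/-- The transition function between the trivializations given by two local sections. -/
noncomputable def change (s t : LocalSection p) (x : X) : ℂ →L[ℂ] ℂ :=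
  (χ (hp.fiberEquivGroup (s.val x) (t.val x)) : ℂ) • ContinuousLinearMap.id ℂ ℂ

theorem change_apply (s t : LocalSection p) {x : X} (hx : x ∈ s.dom) (c : ℂ) :
    change hp χ s t x c = (pretriv hp χ t ⟨x, (pretriv hp χ s).symm x c⟩).2 := by
  rw [pretriv_symm hp χ s hx]
  change _ = fiberEquiv hp χ (t.val x) (mk hp χ (s.val x) c)
  rw [fiberEquiv_eq hp χ (s.val x) (t.val x) _ (hp.fiberEquivGroup_smul_self _), fiberEquiv_mk]
  rfl

/-- The transition functions are locally constant. -/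
theorem change_eventuallyEq (s t : LocalSection p) {x : X} (hs : x ∈ s.dom) (ht : x ∈ t.dom) :
    change hp χ s t =ᶠ[𝓝 x] fun _ => change hp χ s t x := by
  set g := hp.fiberEquivGroup (s.val x) (t.val x) with hg
  have hgx : g • s.toFun x = t.toFun x := hp.fiberEquivGroup_smul_self (s.val x) (e' := t.val x)
  obtain ⟨V, hV, hVg⟩ := hp.disjoint (s.toFun x)
  have h1 : ContinuousAt s.toFun x := s.continuousOn.continuousAt (s.isOpen_dom.mem_nhds hs)
  have h2 : ContinuousAt t.toFun x := t.continuousOn.continuousAt (t.isOpen_dom.mem_nhds ht)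
  have := hp.toContinuousConstSMul
  have h3 : ContinuousAt (fun b => g⁻¹ • t.toFun b) x := h2.const_smul g⁻¹
  have hV' : V ∈ 𝓝 (g⁻¹ • t.toFun x) := by rwa [← hgx, inv_smul_smul]
  filter_upwards [h1 hV, h3 hV'] with b hb hb'
  have hgb : hp.fiberEquivGroup (s.val b) (t.val b) • s.toFun b = t.toFun b :=
    hp.fiberEquivGroup_smul_self (s.val b) (e' := t.val b)
  have h4 : g⁻¹ * hp.fiberEquivGroup (s.val b) (t.val b) = 1 := by
    refine hVg _ ⟨g⁻¹ • t.toFun b, ⟨s.toFun b, hb, ?_⟩, hb'⟩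
    change (g⁻¹ * hp.fiberEquivGroup (s.val b) (t.val b)) • s.toFun b = _
    rw [mul_smul, hgb]
  have h5 : hp.fiberEquivGroup (s.val b) (t.val b) = g := (inv_mul_eq_one.1 h4).symm
  rw [change, change, h5]

/-- The local trivializations of `Y ×_G ℂ_χ` given by the local sections of `p`. -/
noncomputable def prebundle : VectorPrebundle ℂ ℂ (Fiber hp χ) where
  pretrivializationAtlas := Set.range (pretriv hp χ)
  pretrivialization_linear' := by
    rintro _ ⟨s, rfl⟩
    exact ⟨fun b _ => fiberEquiv_isLinearMap hp χ (s.val b)⟩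
  pretrivializationAt x := pretriv hp χ (exists_localSection hp x).choose
  mem_base_pretrivializationAt x := (exists_localSection hp x).choose_spec
  pretrivialization_mem_atlas x := ⟨_, rfl⟩
  exists_coordChange := by
    rintro _ ⟨s, rfl⟩ _ ⟨t, rfl⟩
    exact ⟨change hp χ s t, fun x hx => ((continuousAt_const.congr
      (change_eventuallyEq hp χ s t hx.1 hx.2).symm).continuousWithinAt),
      fun x hx c => change_apply hp χ s t hx.1 c⟩
  totalSpaceMk_isInducing x := by
    set s := (exists_localSection hp x).choose
    have h : (pretriv hp χ s ∘ TotalSpace.mk x : Fiber hp χ x → X × ℂ) = (fun c : ℂ =>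
        (x, (χ (hp.fiberEquivGroup (point hp x) (s.val x)) : ℂ) * c)) ∘
        fiberEquiv hp χ (point hp x) := by
      funext q
      exact Prod.ext rfl (fiberEquiv_eq hp χ (point hp x) (s.val x) _
        (hp.fiberEquivGroup_smul_self _) q)
    rw [h]
    refine Topology.IsInducing.comp ?_ ⟨rfl⟩
    exact (Topology.isInducing_const_prod.2 Topology.IsInducing.id).comp
      (Homeomorph.mulLeft₀ _ (Units.ne_zero _)).isInducing

variable (E : Type w) [NormedAddCommGroup E] [NormedSpace ℂ E] [ChartedSpace E X]

instance instIsContMDiff : (prebundle hp χ).IsContMDiff 𝓘(ℂ, E) ω where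
  exists_contMDiffCoordChange := by
    rintro _ ⟨s, rfl⟩ _ ⟨t, rfl⟩
    exact ⟨change hp χ s t, fun x hx => (contMDiffAt_const.congr_of_eventuallyEq
      (change_eventuallyEq hp χ s t hx.1 hx.2)).contMDiffWithinAt,
      fun x hx c => change_apply hp χ s t hx.1 c⟩

/-- The holomorphic line bundle `Y ×_G ℂ_χ`. -/
noncomputable def lineBundle : HolomorphicLineBundle.{u, v, w} E X :=
  letI := (prebundle hp χ).totalSpaceTopology
  letI := (prebundle hp χ).toFiberBundle
  letI := (prebundle hp χ).toVectorBundle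
  letI := (prebundle hp χ).contMDiffVectorBundle (n := ω) 𝓘(ℂ, E)
  { Fiber := Fiber hp χ }

end Assoc

/-! ## The universal cover and its character map -/

/-- `p : Y → X` is a universal cover of `X`: a surjective covering map with simply connected total
space. -/
structure IsUniversalCover {X : Type u} [TopologicalSpace X] {Y : Type v} [TopologicalSpace Y]
    (p : Y → X) : Prop where
  isCoveringMap : IsCoveringMap p
  surjective : Function.Surjective p
  simplyConnected : SimplyConnectedSpace Y

/-- The group of deck transformations of `p : Y → X`: the homeomorphisms `σ` of `Y` with
`p ∘ σ = p`. -/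
def DeckGroup {X : Type u} {Y : Type v} [TopologicalSpace Y] (p : Y → X) : Subgroup (Y ≃ₜ Y) where
  carrier := {σ | ∀ y, p (σ y) = p y}
  one_mem' _ := rfl
  mul_mem' {σ τ} hσ hτ y := (hσ (τ y)).trans (hτ y)
  inv_mem' {σ} hσ y := by
    have h : σ (σ⁻¹ y) = y := σ.apply_symm_apply y
    rw [← hσ (σ⁻¹ y), h]

instance DeckGroup.instMulAction {X : Type u} {Y : Type v} [TopologicalSpace Y] (p : Y → X) :
    MulAction (DeckGroup p) Y where
  smul σ y := σ.1 y
  one_smul _ := rfl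
  mul_smul _ _ _ := rfl

namespace IsUniversalCover

variable {X : Type u} [TopologicalSpace X] {Y : Type v} [TopologicalSpace Y] {p : Y → X}

theorem locallyPathConnectedSpace (hp : IsUniversalCover p) [LocallyPathConnectedSpace X] :
    LocallyPathConnectedSpace Y := by
  choose e he _ using hp.isCoveringMap.isLocalHomeomorph
  let _ : ChartedSpace X Y :=
    { atlas := Set.range e
      chartAt := e
      mem_chart_source := he
      chart_mem_atlas := fun y => ⟨y, rfl⟩ }
  exact ChartedSpace.locallyPathConnectedSpace X Y

/-- The universal cover of a locally path connected space is the quotient map by the free and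
properly discontinuous action of its group of deck transformations. -/
theorem isQuotientCoveringMap (hp : IsUniversalCover p) [LocallyPathConnectedSpace X] :
    IsQuotientCoveringMap p (DeckGroup p) := by
  have hs := hp.simplyConnected
  have hl := hp.locallyPathConnectedSpace
  have hc := hp.isCoveringMap
  have huniq : ∀ {f g : Y → Y} (_ : Continuous f) (_ : Continuous g)
      (_ : p ∘ f = p ∘ g) (y : Y), f y = g y → f = g :=
    fun hf hg h y hy => hc.eq_of_comp_eq hf hg h y hy
  refine
    { toIsQuotientMap := hc.isQuotientMap hp.surjective
      continuous_const_smul := fun σ => σ.1.continuous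
      apply_eq_iff_mem_orbit := ?_
      disjoint := ?_ }
  · intro a b
    constructor
    · intro hab
      obtain ⟨F, ⟨hF, hF'⟩, -⟩ :=
        hc.existsUnique_continuousMap_lifts ⟨p, hc.continuous⟩ b a hab
      obtain ⟨F', ⟨hG, hG'⟩, -⟩ :=
        hc.existsUnique_continuousMap_lifts ⟨p, hc.continuous⟩ a b hab.symm
      have e1 : ∀ y, p (F y) = p y := fun y => congrFun hF' y
      have e2 : ∀ y, p (F' y) = p y := fun y => congrFun hG' y
      have h1 : (F' ∘ F : Y → Y) = id := huniq (F'.continuous.comp F.continuous) continuous_id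
        (funext fun y => (e2 _).trans (e1 y)) b (by simp [hF, hG])
      have h2 : (F ∘ F' : Y → Y) = id := huniq (F.continuous.comp F'.continuous) continuous_id
        (funext fun y => (e1 _).trans (e2 y)) a (by simp [hF, hG])
      exact ⟨⟨⟨⟨F, F', congrFun h1, congrFun h2⟩, F.continuous, F'.continuous⟩, e1⟩, hF⟩
    · rintro ⟨σ, rfl⟩
      exact σ.2 b
  · intro y
    obtain ⟨e, he, hpe⟩ := hc.isLocalHomeomorph y
    refine ⟨e.source, e.open_source.mem_nhds he, ?_⟩
    rintro σ ⟨_, ⟨z, hz, rfl⟩, hσz⟩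
    have h1 : σ • z = z := e.injOn hσz hz (by rw [← hpe]; exact σ.2 z)
    have h2 : (σ.1 : Y → Y) = id := huniq σ.1.continuous continuous_id
      (funext fun y => σ.2 y) z h1
    exact Subtype.ext (Homeomorph.ext (congrFun h2))

/-- The character of the group of deck transformations given by a character `ρ` of `π₁(X, x₀)`
and a base point `y₀` of `Y` over `x₀`: the deck transformation `σ` corresponds to the class of the
loops at `x₀` whose lifts starting at `y₀` end at `σ y₀`. -/
noncomputable def deckCharacter (hp : IsUniversalCover p) [LocallyPathConnectedSpace X] {x₀ : X}
    (y₀ : p ⁻¹' {x₀}) (ρ : FundamentalGroup X x₀ →* ℂˣ) : DeckGroup p →* ℂˣ :=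
  haveI := hp.simplyConnected
  { toFun := fun σ =>
      ρ ((hp.isQuotientCoveringMap.fundamentalGroupEquiv y₀).symm (MulOpposite.op σ))
    map_one' := by rw [MulOpposite.op_one, map_one, map_one]
    map_mul' := fun σ τ => by rw [MulOpposite.op_mul, map_mul, map_mul, mul_comm] }

/-- The character map `λ : Hom(π₁(X, x₀), ℂˣ) → Pic X` of the universal cover `p : Y → X`, where
`π₁(X, x₀)` acts on `Y` by deck transformations after the choice of a base point `y₀` over `x₀`.
It sends `ρ` to the class of `Y ×_{π₁} ℂ_ρ`, the quotient of `Y × ℂ` by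
`(z, c) ∼ (σ z, ρ(σ) c)`. -/
noncomputable def characterMap (E : Type w) [NormedAddCommGroup E] [NormedSpace ℂ E]
    [ChartedSpace E X] (hp : IsUniversalCover p) {x₀ : X} (y₀ : p ⁻¹' {x₀})
    (ρ : FundamentalGroup X x₀ →* ℂˣ) : Pic.{u, v, w} E X :=
  haveI : LocallyPathConnectedSpace E :=
    letI := NormedSpace.restrictScalars ℝ ℂ E
    inferInstance
  haveI : LocallyPathConnectedSpace X := ChartedSpace.locallyPathConnectedSpace E X
  Quotient.mk (HolomorphicLineBundle.setoid E X)
    (Assoc.lineBundle hp.isQuotientCoveringMap (hp.deckCharacter y₀ ρ) E)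

end IsUniversalCover

/-! Characters of `π₁(X, x₀)` and locally constant Čech classes are compared through functors from
the fundamental groupoid to `ℂˣ`, that is, multiplicative functions `R` on path classes. After a
path `γ x` from `x₀` to every `x` is chosen, a character `ρ` extends to `R(δ) = ρ(γ a · δ · (γ
b)⁻¹)` for `δ` from `a` to `b`. Conversely `R` restricts to loops at `x₀`, and extending this
restriction changes `R` only by a factor depending on the end points.

Fix a cover by path connected sets in each of which two paths with the same ends are homotopic in
`X`; straight lines in charts supply it. Then `R(x → b)`, taken along a path inside the set of `x`,
is well defined, and `R(x → b) / R(y → b)` is a locally constant cocycle. For surjectivity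
(`characterClass_surjective`), a locally constant cocycle `g` glues a principal covering space with
discrete fibre; the inverse of its monodromy is an `R` with `R(x → b) = g x b` at `b` on small sets
(`exists_pathCharacter`), so the cocycle of `R` is `g` again. For injectivity
(`characterClass_injective`), a trivialization of the cocycle provides a function `h` on `X` whose
increments are `R` on small paths; by connectedness of the interval (`eq_div_of_locally`) they are
`R` on all paths, and loops have increment `1`.

For the line bundle (`map_characterClass`), continuing `y₀` along `γ x` and then inside the set of
`x` gives local sections of `p` whose transition functions are exactly the cocycle of `ρ`. They
differ from the sections that define the trivializations by one deck transformation for each `x`,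
hence by a constant coboundary. The isomorphism uses only the cover and the paths `γ`, both on `X`,
so it does not depend on the universal cover. -/

/-! ## Multiplicative functions on homotopy classes of paths -/

/-- A function on the homotopy classes of paths in `X` with values in `G` that turns concatenation
into multiplication. -/
structure PathCharacter (X : Type u) [TopologicalSpace X] (G : Type v) [CommGroup G] where
  toFun : ∀ {a b : X}, Path.Homotopic.Quotient a b → G
  map_trans : ∀ {a b c : X} (γ : Path.Homotopic.Quotient a b) (δ : Path.Homotopic.Quotient b c),
    toFun (γ.trans δ) = toFun γ * toFun δ

namespace PathCharacter

variable {X : Type u} [TopologicalSpace X] {G : Type v} [CommGroup G]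

theorem map_refl (R : PathCharacter X G) (a : X) :
    R.toFun (Path.Homotopic.Quotient.refl a) = 1 := by
  have h := R.map_trans (Path.Homotopic.Quotient.refl a) (Path.Homotopic.Quotient.refl a)
  rw [Path.Homotopic.Quotient.refl_trans] at h
  exact left_eq_mul.1 h

theorem map_symm (R : PathCharacter X G) {a b : X} (γ : Path.Homotopic.Quotient a b) :
    R.toFun γ.symm = (R.toFun γ)⁻¹ := by
  rw [eq_inv_iff_mul_eq_one, ← R.map_trans, Path.Homotopic.Quotient.symm_trans, R.map_refl]

/-- The extension of a character of the fundamental group given by a choice of paths from the base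
point to all points. -/
noncomputable def extend {x₀ : X} (γ : ∀ x, Path.Homotopic.Quotient x₀ x)
    (ρ : FundamentalGroup X x₀ →* G) :
    PathCharacter X G where
  toFun {a b} δ := ρ (FundamentalGroup.fromPath (((γ a).trans δ).trans (γ b).symm))
  map_trans {a b c} δ ε := by
    -- The product of `FundamentalGroup` concatenates paths in the reverse order; commutativity of
    -- `G` absorbs this.
    rw [mul_comm, ← map_mul]
    congr 1
    change _ = (((γ a).trans δ).trans (γ b).symm).trans (((γ b).trans ε).trans (γ c).symm)
    simp only [Path.Homotopic.Quotient.trans_assoc]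
    rw [← Path.Homotopic.Quotient.trans_assoc (γ b).symm, Path.Homotopic.Quotient.symm_trans,
      Path.Homotopic.Quotient.refl_trans]

/-- On loops at the base point the extension is the given character. -/
theorem extend_loop {x₀ : X} (γ : ∀ x, Path.Homotopic.Quotient x₀ x)
    (ρ : FundamentalGroup X x₀ →* G) (σ : FundamentalGroup X x₀) :
    (extend γ ρ).toFun (FundamentalGroup.toPath σ) = ρ σ := by
  let c : FundamentalGroup X x₀ := FundamentalGroup.fromPath (γ x₀)
  -- At the base point the extension conjugates by the loop `γ x₀`, which need not be trivial; a
  -- character with commutative values does not see it.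
  change ρ (c⁻¹ * (σ * c)) = ρ σ
  rw [map_mul, map_mul, mul_comm (ρ σ), ← mul_assoc, ← map_mul, inv_mul_cancel, map_one, one_mul]

/-- The restriction of a multiplicative function on path classes to loops at a point. -/
noncomputable def restrict (R : PathCharacter X G) (x₀ : X) : FundamentalGroup X x₀ →* G where
  toFun σ := R.toFun (FundamentalGroup.toPath σ)
  map_one' := R.map_refl x₀
  map_mul' _ _ := (R.map_trans _ _).trans (mul_comm _ _)

theorem extend_restrict (R : PathCharacter X G) {x₀ : X} (γ : ∀ x, Path.Homotopic.Quotient x₀ x)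
    {a b : X} (δ : Path.Homotopic.Quotient a b) :
    (extend γ (R.restrict x₀)).toFun δ = R.toFun (γ a) * R.toFun δ / R.toFun (γ b) := by
  change R.toFun (((γ a).trans δ).trans (γ b).symm) = _
  rw [R.map_trans, R.map_trans, R.map_symm, div_eq_mul_inv]

/-- If a multiplicative function on path classes is given by the increments of `h` on all
paths that are small of order a given cover, then it is so on all paths. -/
theorem eq_div_of_locally (R : PathCharacter X G) (h : X → G) (𝒰 : PointedCover X)
    (hloc : ∀ (x a b : X) (γ : Path a b), (∀ t, γ t ∈ 𝒰.nhd x) →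
      R.toFun (Path.Homotopic.Quotient.mk γ) = h b / h a)
    {a b : X} (γ : Path a b) : R.toFun (Path.Homotopic.Quotient.mk γ) = h b / h a := by
  -- The discrepancy accumulated up to time `t`. Near each time it is unchanged, because the
  -- intermediate segment is small, so it is constant on the interval.
  let F : unitInterval → G := fun t =>
    R.toFun (Path.Homotopic.Quotient.mk (γ.subpath 0 t)) / h (γ t)
  have hF : IsLocallyConstant F := by
    refine (IsLocallyConstant.iff_eventually_eq F).2 fun t => ?_
    have hnhd : γ ⁻¹' (𝒰.nhd (γ t)) ∈ 𝓝 t :=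
      ((𝒰.nhd (γ t)).2.preimage γ.continuous).mem_nhds (𝒰.mem_nhd _)
    obtain ⟨c, d, -, hS, hSU⟩ := exists_Icc_mem_subset_of_mem_nhds hnhd
    filter_upwards [hS] with s hs
    have key : Path.Homotopic.Quotient.mk (γ.subpath 0 s) =
        (Path.Homotopic.Quotient.mk (γ.subpath 0 t)).trans
          (Path.Homotopic.Quotient.mk (γ.subpath t s)) :=
      (Path.Homotopic.Quotient.eq.2 ⟨Path.Homotopy.subpathTransSubpath γ 0 t s⟩).symm
    have h2 := hloc (γ t) _ _ (γ.subpath t s) fun r => by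
      have hr : γ.subpath t s r ∈ Set.range (γ.subpath t s) := ⟨r, rfl⟩
      rw [Path.range_subpath] at hr
      obtain ⟨q, hq, hq'⟩ := hr
      rw [← hq']
      exact hSU (Set.ordConnected_Icc.uIcc_subset (mem_of_mem_nhds hS) hs hq)
    change _ / _ = _ / _
    rw [key, R.map_trans, h2, mul_div_assoc, div_div_cancel_left, div_eq_mul_inv]
  have h01 : F 1 = F 0 := hF.apply_eq_of_isPreconnected isPreconnected_univ trivial trivial
  have e0 : F 0 = 1 / h a := by
    change R.toFun (Path.Homotopic.Quotient.mk (γ.subpath 0 0)) / h (γ 0) = _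
    rw [Path.subpath_self, γ.source]
    congr 1
    exact R.map_refl _
  have e1 : F 1 = R.toFun (Path.Homotopic.Quotient.mk γ) / h b := by
    change R.toFun (Path.Homotopic.Quotient.mk (γ.subpath 0 1)) / h (γ 1) = _
    rw [Path.subpath_zero_one, congrArg h γ.target]
    congr 1
    -- The end points of `γ.subpath 0 1` are `γ 0` and `γ 1`, which are `a` and `b` only up to a
    -- propositional equality.
    have : ∀ {a' b' : X} (ha : a' = a) (hb : b' = b),
        R.toFun (Path.Homotopic.Quotient.mk (γ.cast ha hb)) =
          R.toFun (Path.Homotopic.Quotient.mk γ) := by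
      rintro _ _ rfl rfl; rfl
    exact this γ.source γ.target
  rw [e0, e1, div_eq_iff_eq_mul] at h01
  rw [h01, one_div, mul_comm, div_eq_mul_inv]

end PathCharacter

/-! ## Small open sets -/

section SmallSets

variable {X : Type u} [TopologicalSpace X]

/-- Any two paths in `U` with the same end points are homotopic in `X`. -/
def IsRelSimplyConnected (U : Set X) : Prop :=
  ∀ ⦃a b : X⦄ (γ δ : Path a b), (∀ t, γ t ∈ U) → (∀ t, δ t ∈ U) → γ.Homotopic δ

theorem IsRelSimplyConnected.mono {U V : Set X} (h : IsRelSimplyConnected U) (hVU : V ⊆ U) :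
    IsRelSimplyConnected V :=
  fun _ _ γ δ hγ hδ => h γ δ (fun t => hVU (hγ t)) fun t => hVU (hδ t)

/-- Every point of a manifold modelled on a real normed space has an open neighbourhood in which
paths with the same end points are homotopic. -/
theorem exists_isRelSimplyConnected (E : Type w) [NormedAddCommGroup E] [NormedSpace ℝ E]
    [ChartedSpace E X] (x : X) : ∃ U : Opens X, x ∈ U ∧ IsRelSimplyConnected (U : Set X) := by
  let φ := chartAt E x
  obtain ⟨r, hr, hball⟩ := Metric.isOpen_iff.1 φ.open_target (φ x)
    (φ.map_source (mem_chart_source E x))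
  refine ⟨⟨φ.source ∩ φ ⁻¹' Metric.ball (φ x) r, φ.isOpen_inter_preimage Metric.isOpen_ball⟩,
    ⟨mem_chart_source E x, Metric.mem_ball_self hr⟩, fun a b γ δ hγ hδ => ?_⟩
  have cγ : Continuous fun t => φ (γ t) :=
    φ.continuousOn.comp_continuous γ.continuous fun t => (hγ t).1
  have cδ : Continuous fun t => φ (δ t) :=
    φ.continuousOn.comp_continuous δ.continuous fun t => (hδ t).1
  -- The straight-line homotopy in the chart; convexity of the ball keeps it inside the target.
  let L : unitInterval × unitInterval → E := fun q =>
    (1 - (q.1 : ℝ)) • φ (γ q.2) + (q.1 : ℝ) • φ (δ q.2)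
  have cL : Continuous L := by
    have h1 := cγ.comp (continuous_snd (X := unitInterval))
    have h2 := cδ.comp (continuous_snd (X := unitInterval))
    have h3 : Continuous fun q : unitInterval × unitInterval => (q.1 : ℝ) :=
      continuous_subtype_val.comp continuous_fst
    exact ((continuous_const.sub h3).smul h1).add (h3.smul h2)
  have hL : ∀ q, L q ∈ φ.target := fun q => hball <|
    convex_ball (φ x) r (hγ q.2).2 (hδ q.2).2 (sub_nonneg.2 q.1.2.2) q.1.2.1 (by ring)
  refine ⟨{ toFun := fun q => φ.symm (L q)
            continuous_toFun := φ.continuousOn_symm.comp_continuous cL hL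
            map_zero_left := fun t => ?_
            map_one_left := fun t => ?_
            prop' := fun s t ht => ?_ }⟩
  · simp [L, φ.left_inv (hγ t).1]
  · simp [L, φ.left_inv (hδ t).1]
  · have hEq : γ t = δ t := by
      rcases ht with rfl | rfl <;> simp
    change φ.symm (L (s, t)) = γ t
    have : L (s, t) = φ (γ t) := by
      simp only [L, ← hEq, ← add_smul]; simp
    rw [this, φ.left_inv (hγ t).1]

end SmallSets

/-! ## Cohomology classes of cocycles -/

namespace Cech

variable {X : Type u} [TopologicalSpace X] {A : UnitSheaf X}

theorem H1.mk_mul (𝒰 : PointedCover X) (g h : cocycles A 𝒰) :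
    H1.mk 𝒰 (g * h) = H1.mk 𝒰 g * H1.mk 𝒰 h := by
  rw [H1.mk, H1.mk, H1.mk, DirectLimit.mul_def]
  rfl

/-- Two cocycles have the same class if and only if they become cohomologous on a common
refinement of their covers. -/
theorem H1.mk_eq_mk_iff {𝒰 𝒱 : PointedCover X} (g : cocycles A 𝒰) (h : cocycles A 𝒱) :
    H1.mk 𝒰 g = H1.mk 𝒱 h ↔ ∃ (𝒲 : PointedCover X) (h𝒰 : 𝒰 ≤ 𝒲) (h𝒱 : 𝒱 ≤ 𝒲)
      (f : ∀ x : X, 𝒲.nhd x → ℂˣ), (∀ x, f x ∈ A.sections (𝒲.nhd x)) ∧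
      ∀ (x y b : X) (hx : b ∈ 𝒲.nhd x) (hy : b ∈ 𝒲.nhd y),
        f x ⟨b, hx⟩ * g.1 x y ⟨b, h𝒰 x hx, h𝒰 y hy⟩ =
          h.1 x y ⟨b, h𝒱 x hx, h𝒱 y hy⟩ * f y ⟨b, hy⟩ := by
  have key : ∀ {α β γ δ : ℂˣ}, α / β = γ⁻¹ * δ ↔ α * γ = δ * β := fun {α β γ δ} => by
    rw [div_eq_iff_eq_mul, mul_assoc, eq_inv_mul_iff_mul_eq, mul_comm γ]
  constructor
  · intro e
    obtain ⟨𝒲, h𝒰, h𝒱, e⟩ := Quotient.exact e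
    obtain ⟨f, hf, hfe⟩ := QuotientGroup.eq.1 e
    refine ⟨𝒲, h𝒰, h𝒱, f, fun x => hf x trivial, fun x y b hx hy => ?_⟩
    exact key.1 (congrFun (congrFun (congrFun hfe x) y) ⟨b, hx, hy⟩)
  · rintro ⟨𝒲, h𝒰, h𝒱, f, hf, hfe⟩
    refine Quotient.sound ⟨𝒲, h𝒰, h𝒱, QuotientGroup.eq.2 ⟨f, fun x _ => hf x, ?_⟩⟩
    funext x y b
    exact key.2 (hfe x y b.1 b.2.1 b.2.2)

theorem H1.exists_eq_mk (c : H1 A) : ∃ (𝒰 : PointedCover X) (g : cocycles A 𝒰), c = H1.mk 𝒰 g := by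
  obtain ⟨𝒰, c, rfl⟩ := DirectLimit.exists_eq_mk _ c
  obtain ⟨g, rfl⟩ := QuotientGroup.mk_surjective c
  exact ⟨𝒰, g, rfl⟩

/-- A cover is refined by a cover by path connected open sets. -/
theorem _root_.PointedCover.exists_isPathConnected_refinement [LocallyPathConnectedSpace X]
    (𝒰 : PointedCover X) :
    ∃ 𝒱 : PointedCover X, 𝒰 ≤ 𝒱 ∧ ∀ x, IsPathConnected (𝒱.nhd x : Set X) :=
  ⟨⟨fun x => ⟨pathComponentIn (𝒰.nhd x) x, (𝒰.nhd x).2.pathComponentIn x⟩,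
    fun x => mem_pathComponentIn_self (𝒰.mem_nhd x)⟩, fun _ => pathComponentIn_subset,
    fun x => isPathConnected_pathComponentIn (𝒰.mem_nhd x)⟩

end Cech

/-! ## Monodromy of locally constant cocycles -/

section Monodromy

variable {X : Type u} [TopologicalSpace X] {G : Type v} [CommGroup G] [TopologicalSpace G]
  [DiscreteTopology G]

/-- The principal bundle with discrete fibre given by a locally constant cocycle. -/
def principalCore (𝒰 : PointedCover X) (g : X → X → X → G)
    (hloc : ∀ x y b, b ∈ 𝒰.nhd x → b ∈ 𝒰.nhd y → ∀ᶠ b' in 𝓝 b, g x y b' = g x y b)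
    (hmul : ∀ x y z b, b ∈ 𝒰.nhd x → b ∈ 𝒰.nhd y → b ∈ 𝒰.nhd z →
      g x y b * g y z b = g x z b) : FiberBundleCore X X G where
  baseSet x := 𝒰.nhd x
  isOpen_baseSet x := (𝒰.nhd x).2
  indexAt x := x
  mem_baseSet_at := 𝒰.mem_nhd
  -- This matches the convention that `g x y` is `φ x ∘ (φ y)⁻¹`: coordinates at `x` become
  -- coordinates at `y` by the factor `g y x`.
  coordChange x y b v := g y x b * v
  coordChange_self x b hb v := by
    rw [left_eq_mul.1 (hmul x x x b hb hb hb).symm, one_mul]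
  continuousOn_coordChange x y := by
    rintro ⟨b, v⟩ ⟨⟨hx, hy⟩, -⟩
    refine ContinuousAt.continuousWithinAt ?_
    have h1 : ContinuousAt (fun b' => g y x b') b :=
      continuousAt_const.congr ((hloc y x b hy hx).mono fun _ h => h.symm)
    exact (h1.comp (x := (b, v)) continuousAt_fst).mul continuousAt_snd
  coordChange_comp x y z b hb v := by
    rw [← mul_assoc, hmul z y x b hb.2 hb.1.2 hb.1.1]

variable {𝒰 : PointedCover X} {g : X → X → X → G}
  {hloc : ∀ x y b, b ∈ 𝒰.nhd x → b ∈ 𝒰.nhd y → ∀ᶠ b' in 𝓝 b, g x y b' = g x y b}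
  {hmul : ∀ x y z b, b ∈ 𝒰.nhd x → b ∈ 𝒰.nhd y → b ∈ 𝒰.nhd z → g x y b * g y z b = g x z b}

/-- The monodromy along paths in a set of the cover. -/
theorem principalCore_monodromy
    (cov : IsCoveringMap (principalCore 𝒰 g hloc hmul).proj) {x a b : X} (γ : Path a b)
    (hγ : ∀ t, γ t ∈ 𝒰.nhd x) (v : G) :
    (cov.monodromy (Path.Homotopic.Quotient.mk γ) ⟨⟨a, g a x a * v⟩, rfl⟩).1 =
      ⟨b, g b x b * v⟩ := by
  let Z := principalCore 𝒰 g hloc hmul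
  -- A point over `c` is recorded in the trivialization indexed by `c` itself; this is the section
  -- with constant coordinate `v` in the trivialization indexed by `x`. Along a path in the set of
  -- `x` it is the lift.
  let s : X → Z.TotalSpace := fun c => ⟨c, g c x c * v⟩
  have hc : Continuous fun t => (⟨γ t, g (γ t) x (γ t) * v⟩ : Z.TotalSpace) := by
    have h1 : Continuous fun t => (Z.localTriv x).toOpenPartialHomeomorph.symm (γ t, v) :=
      (Z.localTriv x).toOpenPartialHomeomorph.continuousOn_symm.comp_continuous
        (γ.continuous.prodMk continuous_const) fun t => (Z.localTriv x).mem_target.2 (hγ t)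
    exact h1
  have h := cov.eq_liftPath_iff (γ := γ.toContinuousMap)
    (e := (⟨a, g a x a * v⟩ : Z.TotalSpace)) γ.source
    (Γ := fun t => (⟨γ t, g (γ t) x (γ t) * v⟩ : Z.TotalSpace)) |>.2
    ⟨hc, rfl, congrArg s γ.source⟩
  exact (congrFun h 1).symm.trans (congrArg s γ.target)

/-- Right translation on the principal bundle. -/
theorem principalCore_continuous_mul (v : G) :
    Continuous fun e : (principalCore 𝒰 g hloc hmul).TotalSpace =>
      (⟨e.1, (show G from e.2) * v⟩ : (principalCore 𝒰 g hloc hmul).TotalSpace) := by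
  let Z := principalCore 𝒰 g hloc hmul
  refine continuous_iff_continuousAt.2 fun e => ?_
  let T := Z.localTriv e.1
  have he : e ∈ T.source := T.mem_source.2 (𝒰.mem_nhd e.1)
  have h1 : ContinuousAt T e := T.toOpenPartialHomeomorph.continuousAt he
  -- Coordinate changes multiply on the left, so right translation is `(b, u) ↦ (b, u * v)` in every
  -- local trivialization.
  have h2 : ContinuousAt (fun e' => ((T e').1, (T e').2 * v)) e :=
    (continuousAt_fst.comp h1).prodMk ((continuousAt_snd.comp h1).mul continuousAt_const)
  have hm : ((T e).1, (T e).2 * v) ∈ T.target := T.mem_target.2 (𝒰.mem_nhd e.1)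
  have h3 := (T.toOpenPartialHomeomorph.symm.continuousAt hm).comp
    (f := fun e' => ((T e').1, (T e').2 * v)) h2
  refine h3.congr ?_
  filter_upwards [T.open_source.mem_nhds he] with e' he'
  have hb : e'.1 ∈ 𝒰.nhd e.1 := T.mem_source.1 he'
  have hs := hmul e'.1 e.1 e'.1 e'.1 (𝒰.mem_nhd _) hb (𝒰.mem_nhd _)
  have hs' := hmul e'.1 e'.1 e'.1 e'.1 (𝒰.mem_nhd _) (𝒰.mem_nhd _) (𝒰.mem_nhd _)
  change (⟨e'.1, g e'.1 e.1 e'.1 * (g e.1 e'.1 e'.1 * (show G from e'.2) * v)⟩ : Z.TotalSpace) = _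
  rw [← mul_assoc, ← mul_assoc, hs, left_eq_mul.1 hs'.symm, one_mul]

/-- Right translation is continuous and covers the identity, so it carries lifts to lifts; by
uniqueness of lifts it commutes with monodromy. Hence the monodromy of a path is determined by the
image of one point. -/
theorem principalCore_monodromy_mul
    (cov : IsCoveringMap (principalCore 𝒰 g hloc hmul).proj) {a b : X}
    (γ : Path.Homotopic.Quotient a b) (v w : G)
    (h : (cov.monodromy γ ⟨⟨a, v⟩, rfl⟩).1 = ⟨b, w⟩) (v' : G) :
    (cov.monodromy γ ⟨⟨a, v * v'⟩, rfl⟩).1 = ⟨b, w * v'⟩ := by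
  obtain ⟨γ⟩ := γ
  let Z := principalCore 𝒰 g hloc hmul
  let m : Z.TotalSpace → Z.TotalSpace := fun e => ⟨e.1, (show G from e.2) * v'⟩
  let Γ := cov.liftPath γ.toContinuousMap (⟨a, v⟩ : Z.TotalSpace) γ.source
  have hΓ := cov.liftPath_lifts γ.toContinuousMap (⟨a, v⟩ : Z.TotalSpace) γ.source
  have hΓ0 : Γ 0 = (⟨a, v⟩ : Z.TotalSpace) := cov.liftPath_zero _ _ _
  have hΓ1 : Γ 1 = (⟨b, w⟩ : Z.TotalSpace) := h
  have h2 := cov.eq_liftPath_iff (γ := γ.toContinuousMap)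
    (e := (⟨a, v * v'⟩ : Z.TotalSpace)) γ.source
    (Γ := fun t => (⟨(Γ t).1, (show G from (Γ t).2) * v'⟩ : Z.TotalSpace)) |>.2
    ⟨(principalCore_continuous_mul v').comp Γ.continuous, hΓ, congrArg m hΓ0⟩
  exact (congrFun h2 1).symm.trans (congrArg m hΓ1)

end Monodromy

/-- A locally constant cocycle gives a multiplicative function on path classes, whose values on
small paths are the quotients of the values of the cocycle. -/
theorem exists_pathCharacter {X : Type u} [TopologicalSpace X] {G : Type v} [CommGroup G]
    (𝒰 : PointedCover X) (g : X → X → X → G)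
    (hloc : ∀ x y b, b ∈ 𝒰.nhd x → b ∈ 𝒰.nhd y → ∀ᶠ b' in 𝓝 b, g x y b' = g x y b)
    (hmul : ∀ x y z b, b ∈ 𝒰.nhd x → b ∈ 𝒰.nhd y → b ∈ 𝒰.nhd z →
      g x y b * g y z b = g x z b) :
    ∃ R : PathCharacter X G, ∀ (x a b : X) (γ : Path a b), (∀ t, γ t ∈ 𝒰.nhd x) →
      R.toFun (Path.Homotopic.Quotient.mk γ) = g x b b / g x a a := by
  let _ : TopologicalSpace G := ⊥
  have : DiscreteTopology G := ⟨rfl⟩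
  let Z := principalCore 𝒰 g hloc hmul
  have cov : IsCoveringMap Z.proj := FiberBundle.isCoveringMap (F := G) (E := Z.Fiber)
  have hex : ∀ {a b : X} (γ : Path.Homotopic.Quotient a b), ∃ w : G,
      (cov.monodromy γ ⟨⟨a, (1 : G)⟩, rfl⟩).1 = ⟨b, w⟩ := by
    intro a b γ
    obtain ⟨⟨b', w⟩, hw⟩ := cov.monodromy γ ⟨⟨a, (1 : G)⟩, rfl⟩
    obtain rfl : b' = b := hw
    exact ⟨w, rfl⟩
  choose S hS using @hex
  have hinj : ∀ {b : X} {w w' : G}, (⟨b, w⟩ : Z.TotalSpace) = ⟨b, w'⟩ → w = w' :=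
    fun h => eq_of_heq (TotalSpace.mk.inj h).2
  -- `S γ` is the end of the lift starting at `1`. On a path from `a` to `b` in the set of `x` it is
  -- `g b x b / g a x a`, so its inverse is the increment of `g x c c`.
  refine ⟨⟨fun γ => (S γ)⁻¹, fun {a b c} γ δ => ?_⟩, fun x a b γ hγ => ?_⟩
  · rw [← mul_inv, inv_inj]
    refine hinj (b := c) ?_
    rw [← hS, cov.monodromy_trans_apply]
    have e : cov.monodromy γ ⟨⟨a, (1 : G)⟩, rfl⟩ = ⟨⟨b, S γ⟩, rfl⟩ := Subtype.ext (hS γ)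
    rw [e]
    have := principalCore_monodromy_mul cov δ 1 (S δ) (hS δ) (S γ)
    rw [one_mul, mul_comm (S δ)] at this
    exact this
  · have h := principalCore_monodromy cov γ hγ (g a x a)⁻¹
    rw [mul_inv_cancel] at h
    have e : S (Path.Homotopic.Quotient.mk γ) = g b x b * (g a x a)⁻¹ :=
      hinj (b := b) ((hS _).symm.trans h)
    have hinv : ∀ c, c ∈ 𝒰.nhd x → g c x c = (g x c c)⁻¹ := fun c hc => by
      have h1 := hmul c c c c (𝒰.mem_nhd c) (𝒰.mem_nhd c) (𝒰.mem_nhd c)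
      rw [eq_inv_iff_mul_eq_one, hmul c x c c (𝒰.mem_nhd c) hc (𝒰.mem_nhd c)]
      exact left_eq_mul.1 h1.symm
    change (S _)⁻¹ = _
    rw [e, hinv b (by simpa using hγ 1), hinv a (by simpa using hγ 0), inv_inv, mul_inv, inv_inv,
      div_eq_mul_inv]

/-! ## The cocycle of a multiplicative function on path classes -/

namespace PathCharacter

variable {X : Type u} [TopologicalSpace X] {𝒱 : PointedCover X}

/-- The class of a path from the centre of a set of a cover to another point of the set. -/
noncomputable def radial (hpc : ∀ x, IsPathConnected (𝒱.nhd x : Set X)) (x b : X)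
    (hb : b ∈ 𝒱.nhd x) : Path.Homotopic.Quotient x b :=
  Path.Homotopic.Quotient.mk ((hpc x).joinedIn x (𝒱.mem_nhd x) b hb).somePath

theorem radial_eq (hpc : ∀ x, IsPathConnected (𝒱.nhd x : Set X))
    (hsc : ∀ x, IsRelSimplyConnected (𝒱.nhd x : Set X)) {x b : X} (γ : Path x b)
    (hγ : ∀ t, γ t ∈ 𝒱.nhd x) (hb : b ∈ 𝒱.nhd x) :
    radial hpc x b hb = Path.Homotopic.Quotient.mk γ :=
  Path.Homotopic.Quotient.eq.2 (hsc x _ _ (fun t => JoinedIn.somePath_mem _ t) hγ)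

/-- The concatenation stays in the set of `x`, where the homotopy class depends only on the end
points. -/
theorem radial_trans (hpc : ∀ x, IsPathConnected (𝒱.nhd x : Set X))
    (hsc : ∀ x, IsRelSimplyConnected (𝒱.nhd x : Set X)) {x a b : X} (γ : Path a b)
    (hγ : ∀ t, γ t ∈ 𝒱.nhd x) (ha : a ∈ 𝒱.nhd x) (hb : b ∈ 𝒱.nhd x) :
    radial hpc x b hb = (radial hpc x a ha).trans (Path.Homotopic.Quotient.mk γ) := by
  rw [radial_eq hpc hsc (((hpc x).joinedIn x (𝒱.mem_nhd x) a ha).somePath.trans γ) ?_ hb]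
  · rfl
  · intro t
    have ht : ((hpc x).joinedIn x (𝒱.mem_nhd x) a ha).somePath.trans γ t ∈
      Set.range (((hpc x).joinedIn x (𝒱.mem_nhd x) a ha).somePath.trans γ) := ⟨t, rfl⟩
    rw [Path.trans_range] at ht
    rcases ht with ⟨s, hs⟩ | ⟨s, hs⟩
    · rw [← hs]; exact JoinedIn.somePath_mem _ s
    · rw [← hs]; exact hγ s

variable [LocallyPathConnectedSpace X]

/-- The cocycle of a multiplicative function on path classes. -/
noncomputable def cocycle (hpc : ∀ x, IsPathConnected (𝒱.nhd x : Set X))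
    (hsc : ∀ x, IsRelSimplyConnected (𝒱.nhd x : Set X)) (R : PathCharacter X ℂˣ) :
    Cech.cocycles (constantUnits X) 𝒱 where
  val x y b := R.toFun (radial hpc x b.1 b.2.1) / R.toFun (radial hpc y b.1 b.2.2)
  property := by
    refine ⟨fun x y => (IsLocallyConstant.iff_eventually_eq _).2 ?_, fun x y z w hx hy hz => ?_⟩
    · rintro ⟨b, hx, hy⟩
      -- A nearby point `b'` is joined to `b` inside the intersection. Prolonging both radial paths
      -- by this one path multiplies numerator and denominator by the same factor.
      have hN := pathComponentIn_mem_nhds ((𝒱.nhd x ⊓ 𝒱.nhd y).2.mem_nhds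
        (show b ∈ _ from ⟨hx, hy⟩))
      filter_upwards [continuous_subtype_val.continuousAt hN] with b' hb'
      have hp : JoinedIn _ b b'.1 := hb'
      have e : ∀ z (hz : b ∈ 𝒱.nhd z) (hz' : b'.1 ∈ 𝒱.nhd z), _ → _ := fun z hz hz' h =>
        radial_trans hpc hsc hp.somePath h hz hz'
      change R.toFun _ / R.toFun _ = R.toFun _ / R.toFun _
      rw [e x hx b'.2.1 fun t => (hp.somePath_mem t).1,
        e y hy b'.2.2 fun t => (hp.somePath_mem t).2,
        R.map_trans, R.map_trans, mul_div_mul_right_eq_div]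
    · exact div_mul_div_cancel _ _ _

end PathCharacter

/-- A locally constant function is constant near every point. -/
theorem IsLocallyConstant.exists_opens {X : Type u} [TopologicalSpace X] {α : Type v}
    {U : Opens X} {f : U → α} (hf : IsLocallyConstant f) {b : X} (hb : b ∈ U) :
    ∃ V : Opens X, b ∈ V ∧ V ≤ U ∧ ∀ b' (hb' : b' ∈ U), b' ∈ V → f ⟨b', hb'⟩ = f ⟨b, hb⟩ := by
  refine ⟨⟨Subtype.val '' (f ⁻¹' {f ⟨b, hb⟩}), U.2.isOpenMap_subtype_val _ (hf.isOpen_fiber _)⟩,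
    ⟨⟨b, hb⟩, rfl, rfl⟩, ?_, ?_⟩
  · rintro _ ⟨c, -, rfl⟩
    exact c.2
  · rintro _ hb' ⟨c, hc, rfl⟩
    exact hc

/-! ## Characters of the fundamental group and cohomology with locally constant coefficients -/

section Characters

variable {X : Type u} [TopologicalSpace X] [LocallyPathConnectedSpace X] {𝒱 : PointedCover X}
  (hpc : ∀ x, IsPathConnected (𝒱.nhd x : Set X))
  (hsc : ∀ x, IsRelSimplyConnected (𝒱.nhd x : Set X))
  {x₀ : X} (γ : ∀ x, Path.Homotopic.Quotient x₀ x)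

/-- The homomorphism that sends a character of the fundamental group to the class of its cocycle. -/
noncomputable def characterClass :
    (FundamentalGroup X x₀ →* ℂˣ) →* Cech.H1 (constantUnits X) :=
  MonoidHom.mk' (fun ρ => Cech.H1.mk 𝒱 (PathCharacter.cocycle hpc hsc (PathCharacter.extend γ ρ)))
    fun ρ ρ' => by
      rw [← Cech.H1.mk_mul]
      congr 1
      refine Subtype.ext ?_
      funext x y b
      exact mul_div_mul_comm _ _ _ _

open PathCharacter

/-- If the cocycle of `ρ` is the coboundary of a family `f`, up to inversion, then `f x * R(x → b)`
does not depend on `x` and defines a global function `h` of `b`. Where `f x` is constant, the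
increments of `h` are the values of `R`; passing to all paths shows that `R` is `1` on loops. -/
theorem characterClass_injective : Function.Injective (characterClass hpc hsc γ) := by
  refine (injective_iff_map_eq_one _).2 fun ρ hρ => ?_
  rw [← map_one (characterClass hpc hsc γ)] at hρ
  obtain ⟨𝒲, h𝒲, h𝒲', f, hf, hfe⟩ := (Cech.H1.mk_eq_mk_iff _ _).1 hρ
  have hfe' : ∀ (x y b : X) (hx : b ∈ 𝒲.nhd x) (hy : b ∈ 𝒲.nhd y), f x ⟨b, hx⟩ *
      (extend γ ρ).toFun (radial hpc x b (h𝒲 x hx)) =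
      f y ⟨b, hy⟩ * (extend γ ρ).toFun (radial hpc y b (h𝒲 y hy)) := by
    intro x y b hx hy
    have h := hfe x y b hx hy
    have h1 : (cocycle hpc hsc (extend γ (1 : FundamentalGroup X x₀ →* ℂˣ))).1 x y
      ⟨b, h𝒲' x hx, h𝒲' y hy⟩ = 1 := div_one 1
    rw [h1, one_mul] at h
    change _ * ((extend γ ρ).toFun _ / (extend γ ρ).toFun _) = _ at h
    rwa [← mul_div_assoc, div_eq_iff_eq_mul] at h
  let h : X → ℂˣ := fun b => f b ⟨b, 𝒲.mem_nhd b⟩ *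
    (extend γ ρ).toFun (radial hpc b b (h𝒲 b (𝒲.mem_nhd b)))
  -- The sets of `𝒲` may be disconnected, so the cover is shrunk until each `f x` is constant.
  choose V hxV hV𝒲 hVf using fun x => IsLocallyConstant.exists_opens (hf x) (𝒲.mem_nhd x)
  refine MonoidHom.ext fun σ => ?_
  rw [← extend_loop γ ρ σ]
  induction σ using Path.Homotopic.Quotient.ind with | mk ε => ?_
  refine ((extend γ ρ).eq_div_of_locally h ⟨V, hxV⟩ (fun x a b δ hδ => ?_) ε).trans (div_self' _)
  have hδ' : ∀ t, δ t ∈ 𝒲.nhd x := fun t => hV𝒲 x (hδ t)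
  have ha : a ∈ 𝒲.nhd x := by simpa using hδ' 0
  have hb : b ∈ 𝒲.nhd x := by simpa using hδ' 1
  have ea : h a = _ := hfe' a x a (𝒲.mem_nhd a) ha
  have eb : h b = _ := hfe' b x b (𝒲.mem_nhd b) hb
  rw [ea, eb, hVf x a ha (by simpa using hδ 0), hVf x b hb (by simpa using hδ 1),
    mul_div_mul_left_eq_div, eq_div_iff_mul_eq', mul_comm, ← map_trans]
  exact congrArg _ (radial_trans hpc hsc δ (fun t => h𝒲 x (hδ' t)) _ _).symm

/-- The preimage is the restriction to loops of the `R` given by the monodromy of `g`. Since `R(x →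
b) = g x b` at `b`, the cocycle identity gives `R(x → b) / R(y → b) = g x y`. -/
theorem characterClass_surjective : Function.Surjective (characterClass hpc hsc γ) := by
  intro c
  obtain ⟨𝒰, g, rfl⟩ := Cech.H1.exists_eq_mk c
  classical
  let g' : X → X → X → ℂˣ := fun x y b =>
    if hb : b ∈ 𝒰.nhd x ⊓ 𝒰.nhd y then g.1 x y ⟨b, hb⟩ else 1
  have hg' : ∀ x y b (hx : b ∈ 𝒰.nhd x) (hy : b ∈ 𝒰.nhd y), g' x y b = g.1 x y ⟨b, hx, hy⟩ :=
    fun x y b hx hy => dif_pos ⟨hx, hy⟩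
  obtain ⟨R, hR⟩ := exists_pathCharacter 𝒰 g'
    (fun x y b hx hy => by
      obtain ⟨V, hbV, hV, hVg⟩ := IsLocallyConstant.exists_opens (g.2.1 x y) ⟨hx, hy⟩
      filter_upwards [V.2.mem_nhds hbV] with b' hb'
      rw [hg' x y b' (hV hb').1 (hV hb').2, hg' x y b hx hy]
      exact hVg b' (hV hb') hb')
    (fun x y z b hx hy hz => by
      rw [hg' x y b hx hy, hg' y z b hy hz, hg' x z b hx hz]
      exact g.2.2 x y z b hx hy hz)
  obtain ⟨𝒯, h𝒰𝒯, h𝒱𝒯⟩ := exists_ge_ge 𝒰 𝒱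
  obtain ⟨𝒲, h𝒯𝒲, hW⟩ := 𝒯.exists_isPathConnected_refinement
  have h𝒰 := h𝒰𝒯.trans h𝒯𝒲
  have h𝒱 := h𝒱𝒯.trans h𝒯𝒲
  -- The radial path lies in the set of `𝒱` but perhaps not in that of `𝒰`. It is homotopic to a
  -- path in the set of `𝒲`, which lies in both.
  have hrad : ∀ x b (hb : b ∈ 𝒲.nhd x),
      R.toFun (radial hpc x b (h𝒱 x hb)) = g.1 x b ⟨b, h𝒰 x hb, 𝒰.mem_nhd b⟩ := by
    intro x b hb
    have hj := (hW x).joinedIn x (𝒲.mem_nhd x) b hb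
    rw [radial_eq hpc hsc hj.somePath (fun t => h𝒱 x (hj.somePath_mem t)),
      hR x x b hj.somePath fun t => h𝒰 x (hj.somePath_mem t),
      hg' x b b (h𝒰 x hb) (𝒰.mem_nhd b), hg' x x x (𝒰.mem_nhd x) (𝒰.mem_nhd x)]
    have h1 := g.2.2 x x x x (𝒰.mem_nhd x) (𝒰.mem_nhd x) (𝒰.mem_nhd x)
    rw [left_eq_mul.1 h1.symm, div_one]
  -- Restricting and extending again multiplies the cocycle by `R(γ x) / R(γ y)`, as the factor at
  -- `b` cancels; this cochain removes it.
  refine ⟨R.restrict x₀, (Cech.H1.mk_eq_mk_iff _ _).2 ⟨𝒲, h𝒱, h𝒰, fun x _ => (R.toFun (γ x))⁻¹,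
    fun x => IsLocallyConstant.const _, fun x y b hx hy => ?_⟩⟩
  change _ * ((extend γ (R.restrict x₀)).toFun _ / (extend γ (R.restrict x₀)).toFun _) = _
  rw [extend_restrict, extend_restrict, hrad x b hx, hrad y b hy,
    ← g.2.2 x y b b (h𝒰 x hx) (h𝒰 y hy) (𝒰.mem_nhd b), div_div_div_cancel_right,
    ← mul_assoc (R.toFun (γ x)), mul_div_mul_right_eq_div, mul_div_assoc,
    inv_mul_cancel_left, div_eq_mul_inv]

/-- The isomorphism between characters of the fundamental group and the first cohomology of the
constant sheaf. -/
noncomputable def characterEquiv :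
    (FundamentalGroup X x₀ →* ℂˣ) ≃* Cech.H1 (constantUnits X) :=
  MulEquiv.ofBijective (characterClass hpc hsc γ)
    ⟨characterClass_injective hpc hsc γ, characterClass_surjective hpc hsc γ⟩

end Characters

/-! ## Comparison with the line bundles of the universal cover -/

namespace Assoc

variable {X : Type u} [TopologicalSpace X] {Y : Type v} [TopologicalSpace Y] {p : Y → X}
  {G : Type v} [Group G] [MulAction G Y] (hp : IsQuotientCoveringMap p G) (χ : G →* ℂˣ)
  (E : Type w) [NormedAddCommGroup E] [NormedSpace ℂ E] [ChartedSpace E X]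

/-- The local section of `p` that defines the preferred trivialization around `x`. -/
noncomputable def preferredSection (x : X) : LocalSection p := (exists_localSection hp x).choose

theorem lineBundle_mem_cover {x b : X} (hb : b ∈ (lineBundle hp χ E).cover.nhd x) :
    b ∈ (preferredSection hp x).dom := hb

/-- The transition functions of `Y ×_G ℂ_χ`: if `g` sends the preferred section around `y` to that
around `x`, then the transition function is `χ g`. -/
theorem lineBundle_transition (x y b : X) (hx : b ∈ (lineBundle hp χ E).cover.nhd x)
    (hy : b ∈ (lineBundle hp χ E).cover.nhd y) (g : G)
    (hg : g • (preferredSection hp y).toFun b = (preferredSection hp x).toFun b) :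
    (lineBundle hp χ E).transition x y ⟨b, hx, hy⟩ = χ g := by
  let sx := (preferredSection hp x).val b
  let sy := (preferredSection hp y).val b
  have h1 : ((lineBundle hp χ E).coord y b hy).symm 1 = mk hp χ sy 1 :=
    ((lineBundle hp χ E).coord y b hy).symm_apply_eq.2 (fiberEquiv_mk hp χ sy 1).symm
  refine Units.ext ((congrArg ((lineBundle hp χ E).coord x b hx) h1).trans ?_)
  change fiberEquiv hp χ sx (mk hp χ sy 1) = _
  rw [fiberEquiv_eq hp χ sy sx g hg, fiberEquiv_mk, mul_one]

end Assoc

theorem Path.Homotopic.Quotient.symm_of_trans {X : Type u} [TopologicalSpace X] {a b c : X}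
    (γ : Path.Homotopic.Quotient a b) (δ : Path.Homotopic.Quotient b c) :
    (γ.trans δ).symm = δ.symm.trans γ.symm := by
  induction γ, δ using Path.Homotopic.Quotient.ind₂ with | mk γ δ => ?_
  rw [← mk_trans, ← mk_symm, Path.trans_symm]
  rfl

/-- Continuing a point of the fibre along a path on which a local section is defined. -/
theorem IsCoveringMap.monodromy_localSection {X : Type u} [TopologicalSpace X] {Y : Type v}
    [TopologicalSpace Y] {p : Y → X} (cov : IsCoveringMap p) (s : Assoc.LocalSection p) {a b : X}
    (γ : Path a b) (hγ : ∀ t, γ t ∈ s.dom) :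
    cov.monodromy (Path.Homotopic.Quotient.mk γ) (s.val a) = s.val b := by
  have h := cov.eq_liftPath_iff (γ := γ.toContinuousMap) (e := s.toFun a)
    (γ.source.trans (s.right_inv a).symm) (Γ := fun t => s.toFun (γ t)) |>.2
    ⟨s.continuousOn.comp_continuous γ.continuous hγ, funext fun t => s.right_inv _,
      congrArg s.toFun γ.source⟩
  exact Subtype.ext ((congrFun h 1).symm.trans (congrArg s.toFun γ.target))

/-- The monodromy commutes with the group of a quotient covering map. -/
theorem IsQuotientCoveringMap.smul_monodromy {X : Type u} [TopologicalSpace X] {Y : Type v}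
    [TopologicalSpace Y] {p : Y → X} {G : Type v} [Group G] [MulAction G Y]
    (hq : IsQuotientCoveringMap p G)
    {a b : X} (γ : Path.Homotopic.Quotient a b) (g : G) (e e' : p ⁻¹' {a}) (h : g • (e : Y) = e') :
    g • (hq.isCoveringMap.monodromy γ e : Y) = hq.isCoveringMap.monodromy γ e' := by
  have h1 := hq.monodromy_toPermFiber (g := g) (γ := γ) (e := e)
  have h2 : hq.toPermFiber a g e = e' := Subtype.ext h
  rw [h2] at h1
  exact (congrArg Subtype.val h1).symm

namespace IsUniversalCover

variable {X : Type u} [TopologicalSpace X] [LocallyPathConnectedSpace X] {Y : Type v}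
  [TopologicalSpace Y] {p : Y → X} (hp : IsUniversalCover p) {x₀ : X} (y₀ : p ⁻¹' {x₀})

/-- The isomorphism of the fundamental group with the opposite deck group is characterized by its
effect on `y₀`, so any loop class that moves `y₀` by monodromy as `σ` does may be used to compute
the character. -/
theorem deckCharacter_eq (ρ : FundamentalGroup X x₀ →* ℂˣ) (σ : DeckGroup p)
    (τ : FundamentalGroup X x₀)
    (h : σ • (y₀ : Y) = hp.isCoveringMap.monodromy (FundamentalGroup.toPath τ) y₀) :
    hp.deckCharacter y₀ ρ σ = ρ τ := by
  have := hp.simplyConnected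
  change ρ ((hp.isQuotientCoveringMap.fundamentalGroupEquiv y₀).symm (MulOpposite.op σ)) = ρ τ
  congr 1
  rw [MulEquiv.symm_apply_eq]
  exact ((hp.isQuotientCoveringMap.fundamentalGroupToMulOpposite_apply_eq_Iff).2 h).symm

variable {𝒱 : PointedCover X} (hpc : ∀ x, IsPathConnected (𝒱.nhd x : Set X))
  (hsc : ∀ x, IsRelSimplyConnected (𝒱.nhd x : Set X)) (γ : ∀ x, Path.Homotopic.Quotient x₀ x)
  (E : Type w) [NormedAddCommGroup E] [NormedSpace ℂ E] [ChartedSpace E X]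

open PathCharacter in
/-- The class of a character in the cohomology of the constant sheaf is mapped to the class of its
line bundle. -/
theorem map_characterClass (ρ : FundamentalGroup X x₀ →* ℂˣ) :
    Cech.H1.map (constantUnits_le_holomorphicUnits E X) (characterClass hpc hsc γ ρ) =
      (Assoc.lineBundle hp.isQuotientCoveringMap (hp.deckCharacter y₀ ρ) E).transitionClass := by
  let hq := hp.isQuotientCoveringMap
  let cov := hq.isCoveringMap
  let χ := hp.deckCharacter y₀ ρ
  let L := Assoc.lineBundle hq χ E
  let s := Assoc.preferredSection hq
  let a : X → DeckGroup p := fun x =>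
    -- The deck transformation that moves the preferred section at `x` to the end of the lift of `γ
    -- x` from `y₀`. By `hend` the moved section is the continuation of `y₀` throughout the set of
    -- `x`.
    hq.fiberEquivGroup ((s x).val x) (cov.monodromy (γ x) y₀)
  have ha : ∀ x, a x • (s x).toFun x = cov.monodromy (γ x) y₀ := fun x =>
    hq.fiberEquivGroup_smul_self ((s x).val x)
  obtain ⟨𝒯, hL𝒯, h𝒱𝒯⟩ := exists_ge_ge L.cover 𝒱
  obtain ⟨𝒲, h𝒯𝒲, hW⟩ := 𝒯.exists_isPathConnected_refinement
  have hL := hL𝒯.trans h𝒯𝒲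
  have h𝒱 := h𝒱𝒯.trans h𝒯𝒲
  have hend : ∀ x b (hb : b ∈ 𝒲.nhd x), a x • (s x).toFun b =
      cov.monodromy ((γ x).trans (radial hpc x b (h𝒱 x hb))) y₀ := by
    intro x b hb
    have hj := (hW x).joinedIn x (𝒲.mem_nhd x) b hb
    rw [cov.monodromy_trans_apply, ← hq.smul_monodromy _ (a x) ((s x).val x) _ (ha x),
      radial_eq hpc hsc hj.somePath fun t => h𝒱 x (hj.somePath_mem t),
      cov.monodromy_localSection (s x) hj.somePath fun t =>
        Assoc.lineBundle_mem_cover hq χ E (hL x (hj.somePath_mem t))]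
    rfl
  refine (Cech.H1.mk_eq_mk_iff _ _).2 ⟨𝒲, h𝒱, hL, fun x _ => (χ (a x))⁻¹,
    fun x => contMDiff_const, fun x y b hx hy => ?_⟩
  let α := (γ x).trans (radial hpc x b (h𝒱 x hx))
  let β := (γ y).trans (radial hpc y b (h𝒱 y hy))
  -- The loop out to `b` through `x` and back through `y`. Its deck transformation `d` commutes with
  -- monodromy, so it takes the continuation of `y₀` along `β` to that along `α`. Thus `d` relates
  -- the moved sections, and `(a x)⁻¹ * d * a y` the preferred ones.
  let τ : FundamentalGroup X x₀ := FundamentalGroup.fromPath (α.trans β.symm)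
  let d : DeckGroup p := hq.fiberEquivGroup y₀ (cov.monodromy (α.trans β.symm) y₀)
  have hd : d • (y₀ : Y) = cov.monodromy (α.trans β.symm) y₀ := hq.fiberEquivGroup_smul_self y₀
  have hχ : χ d = ρ τ := hp.deckCharacter_eq y₀ ρ d τ hd
  have hdβ : d • (cov.monodromy β y₀ : Y) = cov.monodromy α y₀ := by
    rw [hq.smul_monodromy β d y₀ _ hd, ← cov.monodromy_trans_apply,
      Path.Homotopic.Quotient.trans_assoc, Path.Homotopic.Quotient.symm_trans,
      Path.Homotopic.Quotient.trans_refl]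
  have htrans : L.transition x y ⟨b, hL x hx, hL y hy⟩ = χ ((a x)⁻¹ * d * a y) := by
    refine Assoc.lineBundle_transition hq χ E x y b (hL x hx) (hL y hy) _ ?_
    rw [mul_smul, mul_smul, inv_smul_eq_iff]
    exact (congrArg (d • ·) (hend y b hy)).trans (hdβ.trans (hend x b hx).symm)
  have hcoc : (cocycle hpc hsc (extend γ ρ)).1 x y ⟨b, h𝒱 x hx, h𝒱 y hy⟩ = ρ τ := by
    change (extend γ ρ).toFun (radial hpc x b (h𝒱 x hx)) /
      (extend γ ρ).toFun (radial hpc y b (h𝒱 y hy)) = _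
    rw [div_eq_mul_inv, ← map_symm, ← map_trans]
    change ρ (FundamentalGroup.fromPath (((γ x).trans ((radial hpc x b (h𝒱 x hx)).trans
      (radial hpc y b (h𝒱 y hy)).symm)).trans (γ y).symm)) = ρ τ
    congr 1
    have hβ : β.symm = (radial hpc y b (h𝒱 y hy)).symm.trans (γ y).symm :=
      Path.Homotopic.Quotient.symm_of_trans _ _
    change _ = α.trans β.symm
    rw [hβ]
    simp only [α, Path.Homotopic.Quotient.trans_assoc]
  change _ * (cocycle hpc hsc (extend γ ρ)).1 x y ⟨b, h𝒱 x hx, h𝒱 y hy⟩ =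
    L.transition x y ⟨b, hL x hx, hL y hy⟩ * _
  rw [htrans, hcoc, ← hχ, map_mul, map_mul, map_inv, mul_inv_cancel_right]

end IsUniversalCover

theorem mainTheorem10
    {E : Type w} [NormedAddCommGroup E] [NormedSpace ℂ E] [FiniteDimensional ℂ E]
    {X : Type u} [TopologicalSpace X] [T2Space X] [ConnectedSpace X]
    [ChartedSpace E X] [IsManifold 𝓘(ℂ, E) ω X] (x₀ : X) :
    ∃ ψ : (FundamentalGroup X x₀ →* ℂˣ) ≃* Cech.H1 (constantUnits X),
      ∀ (Y : Type v) [TopologicalSpace Y] (p : Y → X) (hp : IsUniversalCover p)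
        (y₀ : p ⁻¹' {x₀}) (ρ : FundamentalGroup X x₀ →* ℂˣ),
        Cech.H1.map (constantUnits_le_holomorphicUnits E X) (ψ ρ) =
          Pic.toH1 (hp.characterMap E y₀ ρ) := by
  -- Real scalars are what balls need to be convex and the straight-line homotopies to make sense.
  let _ := NormedSpace.restrictScalars ℝ ℂ E
  have : LocallyPathConnectedSpace X := ChartedSpace.locallyPathConnectedSpace E X
  have : PathConnectedSpace X := .of_locallyPathConnectedSpace
  choose U hxU hU using exists_isRelSimplyConnected (X := X) E
  obtain ⟨𝒱, hU𝒱, hpc⟩ := (⟨U, hxU⟩ : PointedCover X).exists_isPathConnected_refinement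
  have hsc : ∀ x, IsRelSimplyConnected (𝒱.nhd x : Set X) := fun x => (hU x).mono (hU𝒱 x)
  let γ : ∀ x, Path.Homotopic.Quotient x₀ x := fun x =>
    Path.Homotopic.Quotient.mk (PathConnectedSpace.somePath x₀ x)
  exact ⟨characterEquiv hpc hsc γ, fun Y _ p hp y₀ ρ => hp.map_characterClass y₀ hpc hsc γ E ρ⟩
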